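/- Let $\mathcal G=(\mathcal A\cup\mathcal B,\mathcal E)$ be a finite bipartite graph (agents $\mathcal A$, tasks $\mathcal B$) with weights $w:\mathcal E\to\mathbb R$. An MCM is a maximum cardinality matching. $W(\mathcal E)$ denotes the minimum over all MCMs of $\mathcal E$ of the largest edge weight; an MCM attaining it is a bottleneck assignment. The price of absence of $e$ in $\mathcal E$ is $W(\mathcal E\setminus\{e\})-W(\mathcal E)$ if $\mathcal E\setminus\{e\}$ and $\mathcal E$ have MCMs of the same size, and $+\infty$ otherwise. $\mathcal L(\mathcal M)$ is the set of heaviest edges of $\mathcal M$. A SeqBAP solution is an MCM $\{e_1,\dots,e_n\}$ such that for every $k$ there is a bottleneck assignment $\mathcal M^k$ of the graph $\mathcal G^k$ obtained from $\mathcal G$ by removing the agents and tasks of $e_1,\dots,e_{k-1}$, such that $e_k$ has the largest price of absence in $\mathcal G^k$ among the edges of $\mathcal L(\mathcal M^k)$. A LexBAP solution is an MCM whose tuple of weights in non-increasing order is lexicographically minimal. An augmenting path relative to a matching $N$ is a path with at least one edge, alternating between edges in and not in $N$, whose two end points are not covered by $N$. $\mathrm{AugPath}(N,\mathcal F)$ returns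 some MCM (of the graph considered) contained in $\mathcal F$ if $\mathcal F$ contains an augmenting path relative to $N$, and returns $N$ otherwise. Algorithm 1 has as input $\mathcal G$ and an arbitrary MCM $\mathcal M_0$. Start with $\bar{\mathcal V}=\mathcal A\cup\mathcal B$, $\bar{\mathcal E}=\mathcal E$, $\bar{\mathcal M}=\mathcal M_0$, $\mathcal M_b=\emptyset$, $\mathcal U=\mathrm{True}$. While $\bar{\mathcal M}\neq\emptyset$: let $\bar{\mathcal E}_0$ be the current $\bar{\mathcal E}$, pick any $\bar e\in\mathcal L(\bar{\mathcal M})$, replace $\bar{\mathcal E}$ by $\bar{\mathcal M}\cup\{e\in\bar{\mathcal E}_0: w(e)<\max_{\bar{\mathcal M}}w\}$, and let $\mathcal M_\nu=\mathrm{AugPath}(\bar{\mathcal M}\setminus\{\bar e\},\bar{\mathcal E}\setminus\{\bar e\})$. * If $\mathcal M_\nu\ne\bar{\mathcal M}\setminus\{\bar e\}$, set $\bar{\mathcal M}=\mathcal M_\nu$. * Otherwise let $E'$ be the set of all $e'\in\bar{\mathcal M}$ for which there is no augmenting path relative to $\bar{\mathcal M}\setminus\{e'\}$ in $\{e\in\mathcal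 T: w(e)\le\max_{\bar{\mathcal M}}w\}\setminus\{e'\}$, where $\mathcal T$ is a test set specified below. If $E'\cap\mathcal L(\bar{\mathcal M})=\emptyset$, set $\mathcal U=\mathrm{False}$ and add $\bar e$ to $E'$. Then remove the vertices of $E'$ from $\bar{\mathcal V}$, remove from $\bar{\mathcal E}$ all edges with a removed end point, remove $E'$ from $\bar{\mathcal M}$, and add $E'$ to $\mathcal M_b$. Return $\mathcal M_b$ and $\mathcal U$. Two versions are considered: in the *pruned* version $\mathcal T=\bar{\mathcal E}_0$; in the *full* version $\mathcal T$ is the set of all edges of $\mathcal E$ with both end points in $\bar{\mathcal V}$. **Theorem.** (1) For every $\mathcal G$, $w$ and MCM $\mathcal M_0$, and in either version: every run of the algorithm, whatever the choices made, terminates and can always be continued until $\bar{\mathcal M}=\emptyset$, and its output $\mathcal M_b$ is an MCM that solves the SeqBAP. If $\mathcal U=\mathrm{False}$, the SeqBAP has a further solution. In the full version, if $\mathcal U=\mathrm{True}$, then $\mathcal M_b$ is the unique solution of the LexBAP and the unique solution of the SeqBAP. (2) Either version can be implemented in the following distributed setting. The agents are the vertices of a fixed, undirected, connected communication graph. Besides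 the sets of names $\mathcal A$ and $\mathcal B$, each agent initially knows only its own name, its neighbours in the communication graph, its own incident edges with their weights, and its own edge in $\mathcal M_0$. At each tick of a global clock, all agents simultaneously send one message to all their neighbours and update their memory from the messages received. Precisely: for all finite sets $\mathcal A,\mathcal B$ there is a protocol such that for every connected communication graph on $\mathcal A$, every $\mathcal E$, $w$ and every MCM $\mathcal M_0$ with $|\mathcal A|\ge|\mathcal B|=|\mathcal M_0|$, every message sent consists of an edge of $\mathcal G$, its weight and one bit, and the protocol carries out a complete run of Algorithm 1. That is, at every tick the agents jointly hold a state of the algorithm, each agent holding the part that concerns it (whether it is still in $\bar{\mathcal V}$, its edges in $\bar{\mathcal E}$, $\bar{\mathcal M}$ and $\mathcal M_b$, the remaining tasks, and $\mathcal U$). This state is the initial one at time $0$ and at each tick stays as it is or advances by one iteration of the loop. From some time on, and not before, all agents report that they have halted, and the loop is then finished. -/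

import Mathlib

/-!
Bipartite graphs with agent set `A` and task set `B` (both finite types); the undirected edge
`{i, j}` with `i : A`, `j : B` is the pair `(i, j)`, so an edge set is a `Finset (A × B)`.
Weights are given by `w : A × B → ℝ`, of which only the values on the edge set matter.
-/

namespace Assignment

universe u v

noncomputable section

open scoped Classical

variable {A : Type u} {B : Type v}

/-! ### Matchings and augmenting paths -/

/-- `M` is a matching of the graph with edge set `E`. -/
def IsMatching (E M : Finset (A × B)) : Prop :=
  M ⊆ E ∧ ∀ e ∈ M, ∀ f ∈ M, (e.1 = f.1 ∨ e.2 = f.2) → e = f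

/-- `M` is a maximum cardinality matching (MCM) of the graph with edge set `E`. -/
def IsMCM (E M : Finset (A × B)) : Prop :=
  IsMatching E M ∧ ∀ M', IsMatching E M' → M'.card ≤ M.card

/-- The set of all MCMs. -/
def mcms (E : Finset (A × B)) : Finset (Finset (A × B)) :=
  E.powerset.filter (IsMCM E)

/-- The cardinality of an MCM. -/
def mcmCard (E : Finset (A × B)) : ℕ :=
  (mcms E).sup Finset.card

/-- The undirected graph on the vertex set `A ⊕ B` with edge set `E`. -/
def edgeGraph (E : Finset (A × B)) : SimpleGraph (A ⊕ B) :=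
  SimpleGraph.fromRel (fun x y => ∃ e ∈ E, x = Sum.inl e.1 ∧ y = Sum.inr e.2)

/-- The unordered pair of end points of an edge. -/
def ends (e : A × B) : Sym2 (A ⊕ B) :=
  s(Sum.inl e.1, Sum.inr e.2)

/-- A vertex is free relative to `M` if no edge of `M` is incident to it. -/
def IsFree (M : Finset (A × B)) (x : A ⊕ B) : Prop :=
  ∀ e ∈ M, x ∉ ends e

/-- Every vertex is incident to at most one edge of the path in `M` and to at most one edge of the
path outside `M`. -/
def IsAlternating (M : Finset (A × B)) {G : SimpleGraph (A ⊕ B)} {x y : A ⊕ B}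
    (p : G.Walk x y) : Prop :=
  ∀ z, ∀ e ∈ p.edges, ∀ f ∈ p.edges, z ∈ e → z ∈ f →
    (e ∈ M.image ends ↔ f ∈ M.image ends) → e = f

/-- The edge set `E` contains an augmenting path relative to `M`: a path with at least one edge,
alternating relative to `M`, between two free vertices. -/
def HasAugPath (E M : Finset (A × B)) : Prop :=
  ∃ (x y : A ⊕ B) (p : (edgeGraph E).Walk x y),
    p.IsPath ∧ 0 < p.length ∧ IsAlternating M p ∧ IsFree M x ∧ IsFree M y

/-! ### Bottleneck assignments, price of absence, SeqBAP and LexBAP -/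

/-- The largest weight in `M` (`⊥` if `M` is empty). -/
def maxWeight (w : A × B → ℝ) (M : Finset (A × B)) : EReal :=
  M.sup (fun e => (w e : EReal))

/-- The bottleneck weight: the minimum of the largest weight over all MCMs. -/
def bottleneckWeight (w : A × B → ℝ) (E : Finset (A × B)) : EReal :=
  (mcms E).inf (maxWeight w)

/-- `M` is a bottleneck assignment: an MCM whose largest weight is minimal. -/
def IsBottleneckAssignment (E : Finset (A × B)) (w : A × B → ℝ) (M : Finset (A × B)) : Prop :=
  IsMCM E M ∧ maxWeight w M = bottleneckWeight w E

/-- The edges of `M` with largest weight. -/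
def heaviest (w : A × B → ℝ) (M : Finset (A × B)) : Finset (A × B) :=
  M.filter (fun e => ∀ f ∈ M, w f ≤ w e)

/-- The price of absence of the edge `e`. -/
def price (E : Finset (A × B)) (w : A × B → ℝ) (e : A × B) : EReal :=
  if mcmCard (E.erase e) = mcmCard E then
    bottleneckWeight w (E.erase e) - bottleneckWeight w E
  else ⊤

/-- The edge set of the graph that is left once the agents and the tasks of the edges `e m`,
`m < k`, are removed. -/
def residual {n : ℕ} (E : Finset (A × B)) (e : Fin n → A × B) (k : Fin n) : Finset (A × B) :=
  E.filter (fun f => ∀ m < k, f.1 ≠ (e m).1 ∧ f.2 ≠ (e m).2)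

/-- `M` solves the Sequential Bottleneck Assignment Problem: it is an MCM whose edges can be
enumerated so that each is, among the heaviest edges of some bottleneck assignment of the
remaining graph, one with largest price of absence in that graph. -/
def IsSeqBAP (E : Finset (A × B)) (w : A × B → ℝ) (M : Finset (A × B)) : Prop :=
  IsMCM E M ∧ ∃ e : Fin M.card → A × B, Set.range e = (M : Set (A × B)) ∧
    ∀ k, ∃ Mk, IsBottleneckAssignment (residual E e k) w Mk ∧ e k ∈ heaviest w Mk ∧
      ∀ f ∈ heaviest w Mk, price (residual E e k) w f ≤ price (residual E e k) w (e k)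

/-- The weights of the edges of `M` (with multiplicity) in non-increasing order. -/
def sortedWeights (w : A × B → ℝ) (M : Finset (A × B)) : List ℝ :=
  (M.val.map w).sort (fun x y => y ≤ x)

/-- `M` solves the Lexicographic Bottleneck Assignment Problem. -/
def IsLexBAP (E : Finset (A × B)) (w : A × B → ℝ) (M : Finset (A × B)) : Prop :=
  IsMCM E M ∧ ∀ M', IsMCM E M' → sortedWeights w M' ≠ sortedWeights w M →
    ∃ k < M.card,
      (sortedWeights w M).getD k 0 < (sortedWeights w M').getD k 0 ∧
      ∀ l < k, (sortedWeights w M).getD l 0 = (sortedWeights w M').getD l 0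

/-! ### The algorithm -/

/-- The edges of `E` whose weight is at most the largest weight in `M`. -/
def sublevel (w : A × B → ℝ) (E M : Finset (A × B)) : Finset (A × B) :=
  E.filter (fun e => ∃ f ∈ M, w e ≤ w f)

/-- The edges of `E` whose weight is smaller than the largest weight in `M`. -/
def strictSublevel (w : A × B → ℝ) (E M : Finset (A × B)) : Finset (A × B) :=
  E.filter (fun e => ∃ f ∈ M, w e < w f)

/-- `R` is a possible result of `AugPath (N, E)` in the graph with edge set `G`: some MCM contained
in `E` if `E` contains an augmenting path relative to `N`, and `N` itself otherwise. -/
def AugPathResult (G N E R : Finset (A × B)) : Prop :=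
  (HasAugPath E N ∧ IsMCM G R ∧ R ⊆ E) ∨ (¬ HasAugPath E N ∧ R = N)

/-- The variables of the algorithm that persist between iterations of its loop. -/
@[ext]
structure State (A : Type u) (B : Type v) where
  /-- the remaining agents -/
  agents : Finset A
  /-- the remaining tasks -/
  tasks : Finset B
  /-- the current edge set -/
  edges : Finset (A × B)
  /-- the current matching -/
  cur : Finset (A × B)
  /-- the edges selected so far -/
  chosen : Finset (A × B)
  /-- the flag -/
  flag : Bool

/-- The state before the loop, for the initial matching `M₀`. -/
def State.start [Fintype A] [Fintype B] (E M₀ : Finset (A × B)) : State A B where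
  agents := Finset.univ
  tasks := Finset.univ
  edges := E
  cur := M₀
  chosen := ∅
  flag := true

/-- The edge set in which prices of absence are tested: either the current edge set at the
beginning of the iteration (from which earlier iterations have pruned edges), or all edges of the
input graph between remaining vertices. -/
inductive PriceTest
  | pruned
  | full

/-- The edge set used for testing prices of absence in the state `s`. -/
def testEdges (test : PriceTest) (E : Finset (A × B)) (s : State A B) : Finset (A × B) :=
  match test with
  | PriceTest.pruned => s.edges
  | PriceTest.full => E.filter (fun e => e.1 ∈ s.agents ∧ e.2 ∈ s.tasks)

/-- The edges `e` of `M` for which the search for an augmenting path relative to `M \ {e}` in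
the sublevel set without `e` fails. -/
def positiveEdges (w : A × B → ℝ) (T M : Finset (A × B)) : Finset (A × B) :=
  M.filter (fun e => ¬ HasAugPath ((sublevel w T M).erase e) (M.erase e))

/-- The current edge set after it has been shrunk at the beginning of an iteration. -/
def State.shrunk (w : A × B → ℝ) (s : State A B) : Finset (A × B) :=
  s.cur ∪ strictSublevel w s.edges s.cur

/-- No heaviest edge of the current matching passes the price test. -/
def State.NoPositive (test : PriceTest) (E : Finset (A × B)) (w : A × B → ℝ)
    (s : State A B) : Prop :=
  positiveEdges w (testEdges test E s) s.cur ∩ heaviest w s.cur = ∅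

/-- The edges selected in an iteration in which `e` is found to be a critical bottleneck edge. -/
def State.selected (test : PriceTest) (E : Finset (A × B)) (w : A × B → ℝ)
    (s : State A B) (e : A × B) : Finset (A × B) :=
  if s.NoPositive test E w then insert e (positiveEdges w (testEdges test E s) s.cur)
  else positiveEdges w (testEdges test E s) s.cur

/-- The state after an iteration in which `e` is found to be a critical bottleneck edge. -/
def State.lock (test : PriceTest) (E : Finset (A × B)) (w : A × B → ℝ)
    (s : State A B) (e : A × B) : State A B where
  agents := s.agents \ (s.selected test E w e).image Prod.fst
  tasks := s.tasks \ (s.selected test E w e).image Prod.snd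
  edges := (s.shrunk w).filter (fun f =>
    f.1 ∈ s.agents \ (s.selected test E w e).image Prod.fst ∧
    f.2 ∈ s.tasks \ (s.selected test E w e).image Prod.snd)
  cur := s.cur \ s.selected test E w e
  chosen := s.chosen ∪ s.selected test E w e
  flag := if s.NoPositive test E w then false else s.flag

/-- One iteration of the loop. The heaviest edge `e` of the current matching and the result `R` of
the augmenting path search are arbitrary. There is no step from a state with empty matching. -/
inductive Step (test : PriceTest) (E : Finset (A × B)) (w : A × B → ℝ) :
    State A B → State A B → Prop
  | improve (s : State A B) (e : A × B) (R : Finset (A × B))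
      (he : e ∈ heaviest w s.cur)
      (hR : AugPathResult s.edges (s.cur.erase e) ((s.shrunk w).erase e) R)
      (hne : R ≠ s.cur.erase e) :
      Step test E w s { s with edges := s.shrunk w, cur := R }
  | critical (s : State A B) (e : A × B) (R : Finset (A × B))
      (he : e ∈ heaviest w s.cur)
      (hR : AugPathResult s.edges (s.cur.erase e) ((s.shrunk w).erase e) R)
      (heq : R = s.cur.erase e) :
      Step test E w s (s.lock test E w e)

/-- The states that some run of the algorithm reaches from the initial matching `M₀`. -/
def Reachable [Fintype A] [Fintype B] (test : PriceTest) (E : Finset (A × B)) (w : A × B → ℝ)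
    (M₀ : Finset (A × B)) (s : State A B) : Prop :=
  Relation.ReflTransGen (Step test E w) (State.start E M₀) s

/-! ### The distributed setting -/

/-- What an agent knows initially: its neighbours in the communication graph, its incident edges
with their weights (`weight j = none` if there is no edge to the task `j`), and its edges in the
initial matching. -/
structure LocalInput (A : Type u) (B : Type v) where
  neighbours : Set A
  weight : B → Option ℝ
  matched : Finset B

/-- The input of the agent `i`. -/
def localInput (C : SimpleGraph A) [Fintype B] (E : Finset (A × B)) (w : A × B → ℝ)
    (M₀ : Finset (A × B)) (i : A) : LocalInput A B where
  neighbours := C.neighborSet i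
  weight := fun j => if (i, j) ∈ E then some (w (i, j)) else none
  matched := Finset.univ.filter (fun j => (i, j) ∈ M₀)

/-- The part of the variables of the algorithm that an agent holds: whether it remains, the
remaining tasks, its current edges, its edges in the current matching, its selected edges, and the
flag. -/
structure LocalVars (B : Type v) where
  active : Prop
  tasks : Finset B
  edges : Finset B
  cur : Finset B
  chosen : Finset B
  flag : Bool

/-- The part of the state `s` that belongs to the agent `i`. -/
def State.localVars [Fintype B] (s : State A B) (i : A) : LocalVars B where
  active := i ∈ s.agents
  tasks := s.tasks
  edges := Finset.univ.filter (fun j => (i, j) ∈ s.edges)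
  cur := Finset.univ.filter (fun j => (i, j) ∈ s.cur)
  chosen := Finset.univ.filter (fun j => (i, j) ∈ s.chosen)
  flag := s.flag

/-- A message: one weighted edge and one bit. -/
structure Message (A : Type u) (B : Type v) where
  edge : A × B
  weight : ℝ
  bit : Bool

/-- A synchronous deterministic protocol, the same for all agents. Every agent has a memory that is
initialised from its name and its local input. At each tick of the clock it sends at most one
message to all its neighbours, and updates its memory from the messages of its neighbours. -/
structure Protocol (A : Type u) (B : Type v) where
  Mem : Type (max u v)
  init : A → LocalInput A B → Mem
  send : Mem → Option (Message A B)
  receive : Mem → (A → Option (Message A B)) → Mem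
  vars : Mem → LocalVars B
  halted : Mem → Bool

/-- The memory of each agent at each time when the protocol is run on the communication graph `C`
with the given local inputs. -/
def Protocol.memory (P : Protocol A B) (C : SimpleGraph A) (input : A → LocalInput A B) :
    ℕ → A → P.Mem
  | 0 => fun i => P.init i (input i)
  | t + 1 => fun i => P.receive (P.memory C input t i)
      (fun k => if C.Adj i k then P.send (P.memory C input t k) else none)

/-- Run on the communication graph `C` and the assignment problem `(E, w, M₀)`, the protocol
carries out a complete run of the algorithm: at each time `t` the agents jointly hold a state `S t`
of the algorithm, beginning with the initial state; at each tick this state stays as it is or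
advances by one iteration of the loop; at some time `T` the loop is finished, and from then on (and
not before) every agent reports that it has halted. All messages report an edge of the graph and
its weight. -/
def Protocol.Implements [Fintype A] [Fintype B] (P : Protocol A B) (test : PriceTest)
    (C : SimpleGraph A) (E : Finset (A × B)) (w : A × B → ℝ) (M₀ : Finset (A × B)) : Prop :=
  (∀ t i m, P.send (P.memory C (localInput C E w M₀) t i) = some m →
    m.edge ∈ E ∧ m.weight = w m.edge) ∧
  ∃ S : ℕ → State A B,
    S 0 = State.start E M₀ ∧
    (∀ t, S (t + 1) = S t ∨ Step test E w (S t) (S (t + 1))) ∧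
    (∀ t i, P.vars (P.memory C (localInput C E w M₀) t i) = (S t).localVars i) ∧
    ∃ T, (S T).cur = ∅ ∧
      ∀ t i, P.halted (P.memory C (localInput C E w M₀) t i) = true ↔ T ≤ t

end

end Assignment

namespace Assignment

universe u v

noncomputable section

open scoped Classical

variable {A : Type u} {B : Type v}

/-! ### Berge's lemma -/

/-! Everything rests on a minimality property, `IsLevelMinimal`, of an MCM `C`. With the relation
`≤` it says that, for every level x, no MCM has as its edges of weight at least x a proper subset of
those of `C`. With `<`, an MCM that lies in `C` strictly above x, and is arbitrary at x, must still
contain all edges of `C` of weight at least x.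

The weak form suffices for the SeqBAP: for every proper subset `D` of `C`, the rest `C \ D` is a
bottleneck assignment of the graph left by `D`, so one may repeatedly take a heaviest remaining edge
of largest price (`IsLevelMinimal.isSeqBAP`). The strong form gives uniqueness. At the first edge
where a SeqBAP solution leaves `C`, that edge has price zero, being avoided by the bottleneck
assignment `C \ D`, whereas a heaviest edge of `C \ D` lies in every bottleneck assignment and has
positive price. For the LexBAP one compares at a heaviest edge of the symmetric difference.

By Berge's lemma, a failed search without `e` means that `e` lies in every MCM of the searched edge
set. Hence locked edges are forced, and pruning loses no edge lighter than the current maximum. Both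
operations lift weakly level minimal matchings of the smaller graph to the larger one
(`IsLevelMinimal.union_of_light`), and at the end the empty matching is lifted to the output. In the
full version with flag True, all locked edges are forced in the unpruned graph, so that the strong
form lifts too (`IsLevelMinimal.union`). When the flag first drops, no heaviest edge is forced, and
one can construct two distinct weakly level minimal matchings (`exists_two_isLevelMinimal`). The
loop ends because every iteration deletes an edge from the shrunk edge set.

For the distributed part, agents flood their edges up to a time depending only on the two vertex
sets, after which each of them simulates the same deterministic run on complete data. -/

theorem ends_injective : Function.Injective (ends : A × B → Sym2 (A ⊕ B)) := by
  rintro ⟨a, b⟩ ⟨c, d⟩ h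
  simpa [ends] using h

theorem ends_mem_image {M : Finset (A × B)} {e : A × B} : ends e ∈ M.image ends ↔ e ∈ M :=
  Finset.mem_image.trans
    ⟨fun ⟨_, hf, h⟩ => ends_injective h ▸ hf, fun h => ⟨e, h, rfl⟩⟩

theorem exists_common_end {e f : A × B} :
    (∃ z, z ∈ ends e ∧ z ∈ ends f) ↔ (e.1 = f.1 ∨ e.2 = f.2) := by
  constructor
  · rintro ⟨z | z, h1, h2⟩ <;> simp [ends] at h1 h2
    · exact Or.inl (h1.symm.trans h2)
    · exact Or.inr (h1.symm.trans h2)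
  · rintro (h | h)
    · exact ⟨Sum.inl e.1, by simp [ends], by simp [ends, h]⟩
    · exact ⟨Sum.inr e.2, by simp [ends], by simp [ends, h]⟩

theorem IsMatching.eq_of_mem_ends {E M : Finset (A × B)} (hM : IsMatching E M) {e f : A × B}
    (he : e ∈ M) (hf : f ∈ M) {z : A ⊕ B} (h1 : z ∈ ends e) (h2 : z ∈ ends f) : e = f :=
  hM.2 e he f hf (exists_common_end.1 ⟨z, h1, h2⟩)

theorem isMatching_iff {E M : Finset (A × B)} :
    IsMatching E M ↔
      M ⊆ E ∧ ∀ e ∈ M, ∀ f ∈ M, ∀ z, z ∈ ends e → z ∈ ends f → e = f :=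
  ⟨fun h => ⟨h.1, fun _ he _ hf _ h1 h2 => h.eq_of_mem_ends he hf h1 h2⟩,
    fun h => ⟨h.1, fun e he f hf hef =>
      let ⟨z, h1, h2⟩ := exists_common_end.2 hef
      h.2 e he f hf z h1 h2⟩⟩

theorem IsMatching.insert_of_isFree {E M : Finset (A × B)} (hM : IsMatching E M) {e : A × B}
    (he : e ∈ E) {x y : A ⊕ B} (hxy : ends e = s(x, y)) (hx : IsFree M x) (hy : IsFree M y) :
    IsMatching E (insert e M) := by
  have key : ∀ f ∈ M, ∀ z, z ∈ ends e → z ∈ ends f → False := by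
    intro f hf z h1 h2
    rw [hxy, Sym2.mem_iff] at h1
    rcases h1 with rfl | rfl
    · exact hx f hf h2
    · exact hy f hf h2
  rw [isMatching_iff]
  refine ⟨Finset.insert_subset he hM.1, fun f hf g hg z h1 h2 => ?_⟩
  rcases Finset.mem_insert.1 hf with hf' | hf' <;> rcases Finset.mem_insert.1 hg with hg' | hg'
  · rw [hf', hg']
  · exact (key g hg' z (hf' ▸ h1) h2).elim
  · exact (key f hf' z (hg' ▸ h2) h1).elim
  · exact hM.eq_of_mem_ends hf' hg' h1 h2

theorem IsMatching.subset {E M N : Finset (A × B)} (hM : IsMatching E M) (h : N ⊆ M) :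
    IsMatching E N :=
  ⟨h.trans hM.1, fun e he f hf => hM.2 e (h he) f (h hf)⟩

theorem edgeGraph_adj {E : Finset (A × B)} {x y : A ⊕ B} :
    (edgeGraph E).Adj x y ↔ ∃ e ∈ E, ends e = s(x, y) := by
  simp only [edgeGraph, SimpleGraph.fromRel_adj, ends]
  constructor
  · rintro ⟨-, ⟨e, he, rfl, rfl⟩ | ⟨e, he, rfl, rfl⟩⟩
    · exact ⟨e, he, rfl⟩
    · exact ⟨e, he, Sym2.eq_swap⟩
  · rintro ⟨e, he, h⟩
    rcases Sym2.eq_iff.1 h with ⟨rfl, rfl⟩ | ⟨rfl, rfl⟩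
    · exact ⟨by simp, Or.inl ⟨e, he, rfl, rfl⟩⟩
    · exact ⟨by simp, Or.inr ⟨e, he, rfl, rfl⟩⟩

/-- Induction on the length: either the second vertex is free and the first edge can be added, or
the first two edges are exchanged. The exchange keeps the cardinality and leaves a shorter
augmenting path. -/
theorem exists_larger_matching_of_path {E : Finset (A × B)} (n : ℕ) :
    ∀ (N : Finset (A × B)) (x y : A ⊕ B) (p : (edgeGraph E).Walk x y), p.length = n →
      IsMatching E N → p.IsPath → 0 < p.length → IsAlternating N p → IsFree N x → IsFree N y →
      ∃ N', IsMatching E N' ∧ N.card < N'.card := by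
  induction n using Nat.strong_induction_on with
  | _ n ih =>
    intro N x y p hn hN hp hpos halt hx hy
    cases p with
    | nil => simp at hpos
    | @cons _ z _ h p' =>
      obtain ⟨e, heE, he⟩ := edgeGraph_adj.1 h
      have heN : e ∉ N := fun h' => hx e h' (by simp [he])
      by_cases hz : IsFree N z
      · exact ⟨insert e N, hN.insert_of_isFree heE he hx hz, by
          rw [Finset.card_insert_of_notMem heN]; omega⟩
      cases p' with
      | nil => exact absurd hy hz
      | @cons _ z' _ h' q =>
        obtain ⟨g, hgE, hg⟩ := edgeGraph_adj.1 h'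
        rw [SimpleGraph.Walk.cons_isPath_iff, SimpleGraph.Walk.cons_isPath_iff] at hp
        obtain ⟨⟨hq, hzq⟩, hxq⟩ := hp
        simp only [SimpleGraph.Walk.support_cons, List.mem_cons, not_or] at hxq
        have hxz : x ≠ z := hxq.1
        have hxz' : x ≠ z' := fun h'' => hxq.2 (h'' ▸ q.start_mem_support)
        have hzz' : z ≠ z' := fun h'' => hzq (h'' ▸ q.start_mem_support)
        have hxy : x ≠ y := fun h'' => hxq.2 (h'' ▸ q.end_mem_support)
        have hzy : z ≠ y := fun h'' => hzq (h'' ▸ q.end_mem_support)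
        have hgN : g ∈ N := by
          -- Two edges outside `N` that meet at `z` would coincide by alternation, but a path does
          -- not turn back.
          by_contra hgN
          have := halt z (ends e) (by simp [he]) (ends g) (by simp [hg]) (by simp [he])
            (by simp [hg]) (by simp only [ends_mem_image, heN, hgN])
          rw [he, hg, Sym2.eq_iff] at this
          rcases this with ⟨h1, -⟩ | ⟨h1, -⟩
          · exact hxz h1
          · exact hxz' h1
        have hz'y : z' ≠ y := fun h'' => hy g hgN (by simp [hg, h''])
        have hx1 : IsFree (N.erase g) x := fun f hf => hx f (Finset.mem_of_mem_erase hf)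
        have hfree : ∀ t ∈ ends g, IsFree (N.erase g) t := fun t ht f hf htf =>
          (Finset.mem_erase.1 hf).1
            (hN.eq_of_mem_ends (Finset.mem_erase.1 hf).2 hgN htf ht)
        have hN1 : IsMatching E (insert e (N.erase g)) :=
          (hN.subset (Finset.erase_subset _ _)).insert_of_isFree heE he hx1
            (hfree z (by simp [hg]))
        have hcard : (insert e (N.erase g)).card = N.card := by
          rw [Finset.card_insert_of_notMem (fun h => heN (Finset.mem_of_mem_erase h)),
            Finset.card_erase_add_one hgN]
        rw [← hcard]
        -- The exchange only affects the first two edges, so the tail alternates relative to the new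
        -- matching as well.
        have himg : ∀ f ∈ q.edges,
            (f ∈ (insert e (N.erase g)).image ends ↔ f ∈ N.image ends) := by
          intro f hf
          have h1 : f ≠ ends e := by
            rintro rfl
            rw [he] at hf
            exact hxq.2 (q.fst_mem_support_of_mem_edges hf)
          have h2 : f ≠ ends g := by
            rintro rfl
            rw [hg] at hf
            exact hzq (q.fst_mem_support_of_mem_edges hf)
          simp only [Finset.mem_image, Finset.mem_insert, Finset.mem_erase]
          constructor
          · rintro ⟨a, rfl | ⟨-, ha⟩, rfl⟩
            · exact absurd rfl h1
            · exact ⟨a, ha, rfl⟩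
          · rintro ⟨a, ha, rfl⟩
            exact ⟨a, Or.inr ⟨fun h => h2 (by rw [h]), ha⟩, rfl⟩
        refine ih q.length (by simp at hn; omega) _ z' y q rfl hN1 hq ?_ ?_ ?_ ?_
        · by_contra h0
          exact hz'y (SimpleGraph.Walk.eq_of_length_eq_zero (p := q) (by omega))
        · intro t f hf f' hf' h1 h2 h3
          rw [himg f hf, himg f' hf'] at h3
          exact halt t f (by simp [hf]) f' (by simp [hf']) h1 h2 h3
        · intro f hf
          rcases Finset.mem_insert.1 hf with rfl | hf
          · simp [he, hxz'.symm, hzz'.symm]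
          · exact hfree z' (by simp [hg]) f hf
        · intro f hf
          rcases Finset.mem_insert.1 hf with rfl | hf
          · simp [he, hxy.symm, hzy.symm]
          · exact hy f (Finset.mem_of_mem_erase hf)

/-- The agent `a'` is matched to a task that can be reached from `a` by an edge outside `N`. -/
def AltStep (E N : Finset (A × B)) (a a' : A) : Prop :=
  ∃ b, (a, b) ∈ E ∧ (a, b) ∉ N ∧ (a', b) ∈ N

/-- The dart is directed from agents to tasks outside `N` and from tasks to agents in `N`. -/
def IsAltDart (N : Finset (A × B)) {G : SimpleGraph (A ⊕ B)} (d : G.Dart) : Prop :=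
  (∃ a b, (a, b) ∉ N ∧ d.fst = Sum.inl a ∧ d.snd = Sum.inr b) ∨
    (∃ a b, (a, b) ∈ N ∧ d.fst = Sum.inr b ∧ d.snd = Sum.inl a)

theorem exists_altWalk {E N : Finset (A × B)} (hN : N ⊆ E) {a a' : A}
    (h : Relation.ReflTransGen (AltStep E N) a a') :
    ∃ p : (edgeGraph E).Walk (Sum.inl a) (Sum.inl a'), ∀ d ∈ p.darts, IsAltDart N d := by
  induction h with
  | refl => exact ⟨SimpleGraph.Walk.nil, by simp⟩
  | @tail c a' _ h ih =>
    obtain ⟨p, hp⟩ := ih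
    obtain ⟨b, h1, h2, h3⟩ := h
    have e1 : (edgeGraph E).Adj (Sum.inl c) (Sum.inr b) := edgeGraph_adj.2 ⟨_, h1, rfl⟩
    have e2 : (edgeGraph E).Adj (Sum.inr b) (Sum.inl a') :=
      edgeGraph_adj.2 ⟨_, hN h3, Sym2.eq_swap⟩
    refine ⟨p.append (SimpleGraph.Walk.cons e1 (SimpleGraph.Walk.cons e2 .nil)), ?_⟩
    intro d hd
    simp only [SimpleGraph.Walk.darts_append, SimpleGraph.Walk.darts_cons,
      SimpleGraph.Walk.darts_nil, List.mem_append, List.mem_cons, List.not_mem_nil,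
      or_false] at hd
    rcases hd with hd | rfl | rfl
    · exact hp d hd
    · exact Or.inl ⟨c, b, h2, rfl, rfl⟩
    · exact Or.inr ⟨a', b, h3, rfl, rfl⟩

/-- Orientation encodes membership in `N`: two edges of the same kind at a vertex both enter it or
both leave it, and a path enters and leaves each vertex at most once. -/
theorem isAlternating_of_altDarts {N : Finset (A × B)} {G : SimpleGraph (A ⊕ B)} {x y : A ⊕ B}
    {p : G.Walk x y} (hp : p.IsPath) (hd : ∀ d ∈ p.darts, IsAltDart N d) :
    IsAlternating N p := by
  have hfst : ∀ d ∈ p.darts, ∀ d' ∈ p.darts, d.fst = d'.fst → d = d' := by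
    have : (p.darts.map (·.fst)).Nodup := by
      rw [SimpleGraph.Walk.map_fst_darts]
      exact hp.support_nodup.sublist (List.dropLast_sublist _)
    exact fun d h d' h' e => List.inj_on_of_nodup_map this h h' e
  have hsnd : ∀ d ∈ p.darts, ∀ d' ∈ p.darts, d.snd = d'.snd → d = d' := by
    have : (p.darts.map (·.snd)).Nodup := by
      rw [SimpleGraph.Walk.map_snd_darts]
      exact hp.support_nodup.sublist (List.tail_sublist _)
    exact fun d h d' h' e => List.inj_on_of_nodup_map this h h' e
  have hedge : ∀ d : G.Dart, d.edge = s(d.fst, d.snd) := fun d => rfl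
  have hswap : ∀ a : A, ∀ b : B, s(Sum.inr b, Sum.inl a) = ends (a, b) := fun a b => Sym2.eq_swap
  have hends : ∀ a : A, ∀ b : B, s(Sum.inl a, Sum.inr b) = ends (a, b) := fun a b => rfl
  intro z e he f hf hze hzf hef
  obtain ⟨d, hdp, rfl⟩ := List.mem_map.1 he
  obtain ⟨d', hdp', rfl⟩ := List.mem_map.1 hf
  rcases hd d hdp with ⟨a, b, h1, h2, h3⟩ | ⟨a, b, h1, h2, h3⟩ <;>
  rcases hd d' hdp' with ⟨a', b', h1', h2', h3'⟩ | ⟨a', b', h1', h2', h3'⟩ <;>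
  simp only [hedge, h2, h3, h2', h3', hswap, hends, ends_mem_image, h1, h1', iff_true,
    iff_false, not_true] at hef hze hzf ⊢
  · rcases exists_common_end.1 ⟨z, hze, hzf⟩ with h | h
    · obtain rfl := hfst d hdp d' hdp' (by rw [h2, h2']; exact congrArg _ h)
      simp_all
    · obtain rfl := hsnd d hdp d' hdp' (by rw [h3, h3']; exact congrArg _ h)
      simp_all
  · rcases exists_common_end.1 ⟨z, hze, hzf⟩ with h | h
    · obtain rfl := hsnd d hdp d' hdp' (by rw [h3, h3']; exact congrArg _ h)
      simp_all
    · obtain rfl := hfst d hdp d' hdp' (by rw [h2, h2']; exact congrArg _ h)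
      simp_all

theorem hasAugPath_of_altReach {E N : Finset (A × B)} (hN : N ⊆ E) {a a' : A} {b : B}
    (ha : IsFree N (Sum.inl a)) (hb : IsFree N (Sum.inr b))
    (h : Relation.ReflTransGen (AltStep E N) a a') (hab : (a', b) ∈ E) : HasAugPath E N := by
  obtain ⟨p, hp⟩ := exists_altWalk hN h
  have e1 : (edgeGraph E).Adj (Sum.inl a') (Sum.inr b) := edgeGraph_adj.2 ⟨_, hab, rfl⟩
  have hpe : ∀ d ∈ (p.concat e1).darts, IsAltDart N d := by
    intro d hd
    rw [SimpleGraph.Walk.darts_concat, List.concat_eq_append, List.mem_append,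
      List.mem_singleton] at hd
    rcases hd with hd | rfl
    · exact hp d hd
    · exact Or.inl ⟨a', b, fun h' => hb _ h' (by simp [ends]), rfl, rfl⟩
  -- Cutting loops out of a walk keeps only darts of that walk, so the orientation condition, being
  -- local, passes to the path.
  refine ⟨_, _, (p.concat e1).bypass, SimpleGraph.Walk.bypass_isPath _, ?_, ?_, ha, hb⟩
  · by_contra h0
    exact Sum.inl_ne_inr (SimpleGraph.Walk.eq_of_length_eq_zero
      (p := (p.concat e1).bypass) (by omega))
  · exact isAlternating_of_altDarts (SimpleGraph.Walk.bypass_isPath _)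
      fun d hd => hpe d (SimpleGraph.Walk.darts_bypass_subset_darts _ hd)

theorem HasAugPath.exists_larger {E N : Finset (A × B)} (hN : IsMatching E N)
    (h : HasAugPath E N) : ∃ N', IsMatching E N' ∧ N.card < N'.card :=
  let ⟨x, y, p, h1, h2, h3, h4, h5⟩ := h
  exists_larger_matching_of_path _ N x y p rfl hN h1 h2 h3 h4 h5

/-- Kőnig's argument: without an augmenting path, the tasks adjacent to agents reachable from free
agents, and the unreachable agents, are all covered by `N`. Sending each edge of `N'` to the edge of
`N` at its covered end embeds `N'` in `N`. -/
theorem hasAugPath_of_card_lt {E N N' : Finset (A × B)} (hN : IsMatching E N)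
    (hN' : IsMatching E N') (hlt : N.card < N'.card) : HasAugPath E N := by
  by_contra hno
  set R : Set A := {a | ∃ a₀, IsFree N (Sum.inl a₀) ∧ Relation.ReflTransGen (AltStep E N) a₀ a}
  have hR : ∀ e ∈ N', ∃ g ∈ N, (e.1 ∈ R ∧ g.1 ∈ R ∧ g.2 = e.2) ∨ (e.1 ∉ R ∧ g.1 = e.1) := by
    rintro ⟨a, b⟩ he
    by_cases haR : a ∈ R
    · obtain ⟨a₀, h0, h1⟩ := haR
      have hb : ¬ IsFree N (Sum.inr b) := fun hb =>
        hno (hasAugPath_of_altReach hN.1 h0 hb h1 (hN'.1 he))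
      simp only [IsFree, not_forall, not_not] at hb
      obtain ⟨⟨a', b'⟩, hg, hbg⟩ := hb
      obtain rfl : b = b' := by simpa [ends] using hbg
      refine ⟨_, hg, Or.inl ⟨⟨a₀, h0, h1⟩, ?_, rfl⟩⟩
      by_cases hab : (a, b) ∈ N
      · have := hN.2 _ hab _ hg (Or.inr rfl)
        simp only [Prod.mk.injEq, and_true] at this
        exact this ▸ ⟨a₀, h0, h1⟩
      · exact ⟨a₀, h0, h1.tail ⟨b, hN'.1 he, hab, hg⟩⟩
    · have ha : ¬ IsFree N (Sum.inl a) := fun ha => haR ⟨a, ha, .refl⟩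
      simp only [IsFree, not_forall, not_not] at ha
      obtain ⟨⟨a', b'⟩, hg, hag⟩ := ha
      obtain rfl : a = a' := by simpa [ends] using hag
      exact ⟨_, hg, Or.inr ⟨haR, rfl⟩⟩
  choose! φ hφ h using hR
  refine absurd (Finset.card_le_card_of_injOn φ hφ ?_) (not_le.2 hlt)
  -- Whether the agent of the image is reachable tells which of the two cases an edge came from.
  intro e he f hf hef
  have h1 := h e he
  have h2 := h f hf
  rw [hef] at h1
  rcases h1 with ⟨h1, h3, h4⟩ | ⟨h1, h3⟩ <;> rcases h2 with ⟨h2, h5, h6⟩ | ⟨h2, h5⟩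
  · exact hN'.2 e he f hf (Or.inr (h4.symm.trans h6))
  · exact absurd (h5 ▸ h3) h2
  · exact absurd (h3 ▸ h5) h1
  · exact hN'.2 e he f hf (Or.inl (h3.symm.trans h5))

/-! ### Removing the vertices of a set of edges -/

/-- The edges of `G` that have no end point in common with an edge of `D`. -/
def minus (G D : Finset (A × B)) : Finset (A × B) :=
  G.filter (fun f => ∀ d ∈ D, f.1 ≠ d.1 ∧ f.2 ≠ d.2)

theorem mem_minus {G D : Finset (A × B)} {f : A × B} :
    f ∈ minus G D ↔ f ∈ G ∧ ∀ d ∈ D, f.1 ≠ d.1 ∧ f.2 ≠ d.2 :=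
  Finset.mem_filter

theorem minus_subset (G D : Finset (A × B)) : minus G D ⊆ G :=
  Finset.filter_subset _ _

theorem disjoint_of_subset_minus {G D S : Finset (A × B)} (h : S ⊆ minus G D) :
    Disjoint S D :=
  Finset.disjoint_left.2 fun f hf hd => ((mem_minus.1 (h hf)).2 f hd).1 rfl

theorem IsMatching.mono {G G' M : Finset (A × B)} (hM : IsMatching G M) (h : G ⊆ G') :
    IsMatching G' M :=
  ⟨hM.1.trans h, hM.2⟩

theorem IsMatching.sdiff {G M D : Finset (A × B)} (hM : IsMatching G M) (hD : D ⊆ M) :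
    IsMatching (minus G D) (M \ D) := by
  refine ⟨fun f hf => ?_, (hM.subset Finset.sdiff_subset).2⟩
  rw [Finset.mem_sdiff] at hf
  refine mem_minus.2 ⟨hM.1 hf.1, fun d hd => ⟨fun h => hf.2 ?_, fun h => hf.2 ?_⟩⟩
  · exact hM.2 f hf.1 d (hD hd) (Or.inl h) ▸ hd
  · exact hM.2 f hf.1 d (hD hd) (Or.inr h) ▸ hd

theorem IsMatching.union {G S D : Finset (A × B)} (hS : IsMatching (minus G D) S)
    (hD : IsMatching G D) : IsMatching G (S ∪ D) := by
  refine ⟨Finset.union_subset (hS.1.trans (minus_subset _ _)) hD.1, fun e he f hf hef => ?_⟩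
  rcases Finset.mem_union.1 he with he | he <;> rcases Finset.mem_union.1 hf with hf | hf
  · exact hS.2 e he f hf hef
  · have := (mem_minus.1 (hS.1 he)).2 f hf
    tauto
  · have := (mem_minus.1 (hS.1 hf)).2 e he
    exact (hef.elim (fun h => this.1 h.symm) (fun h => this.2 h.symm)).elim
  · exact hD.2 e he f hf hef

theorem IsMCM.card_eq {G M N : Finset (A × B)} (hM : IsMCM G M) (hN : IsMCM G N) :
    M.card = N.card :=
  le_antisymm (hN.2 M hM.1) (hM.2 N hN.1)

theorem IsMCM.of_card {G M N : Finset (A × B)} (hM : IsMCM G M) (hN : IsMatching G N)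
    (h : M.card ≤ N.card) : IsMCM G N :=
  ⟨hN, fun N' hN' => (hM.2 N' hN').trans h⟩

theorem IsMCM.of_subset {G G' M : Finset (A × B)} (hM : IsMCM G M) (h : G' ⊆ G) (hM' : M ⊆ G') :
    IsMCM G' M :=
  ⟨⟨hM', hM.1.2⟩, fun N hN => hM.2 N (hN.mono h)⟩

theorem IsMCM.mono {G G' M N : Finset (A × B)} (hM : IsMCM G M) (h : G' ⊆ G) (hM' : M ⊆ G')
    (hN : IsMCM G' N) : IsMCM G N :=
  hM.of_card (hN.1.mono h) (hN.2 M ⟨hM', hM.1.2⟩)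

/-- A matching of the smaller graph can be completed by `D`, so a larger one there would contradict
maximality of `M`. -/
theorem IsMCM.sdiff {G M D : Finset (A × B)} (hM : IsMCM G M) (hD : D ⊆ M) :
    IsMCM (minus G D) (M \ D) := by
  refine ⟨hM.1.sdiff hD, fun N hN => ?_⟩
  have h1 := hM.2 _ (hN.union (hM.1.subset hD))
  rw [Finset.card_union_of_disjoint (disjoint_of_subset_minus hN.1)] at h1
  rw [Finset.card_sdiff_of_subset hD]
  omega

theorem IsMCM.union {G M D S : Finset (A × B)} (hM : IsMCM G M) (hD : D ⊆ M)
    (hS : IsMCM (minus G D) S) : IsMCM G (S ∪ D) := by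
  refine hM.of_card (hS.1.union (hM.1.subset hD)) ?_
  have h1 := hS.2 _ (hM.1.sdiff hD)
  rw [Finset.card_sdiff_of_subset hD] at h1
  rw [Finset.card_union_of_disjoint (disjoint_of_subset_minus hS.1.1)]
  have := Finset.card_le_card hD
  omega

theorem exists_isMCM (G : Finset (A × B)) : ∃ M, IsMCM G M := by
  obtain ⟨M, hM, h⟩ := (G.powerset.filter (IsMatching G)).exists_max_image Finset.card
    ⟨∅, by simp [IsMatching]⟩
  exact ⟨M, (Finset.mem_filter.1 hM).2, fun N hN =>
    h N (Finset.mem_filter.2 ⟨Finset.mem_powerset.2 hN.1, hN⟩)⟩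

/-! ### Bottleneck weights -/

theorem mem_mcms {G M : Finset (A × B)} : M ∈ mcms G ↔ IsMCM G M :=
  Finset.mem_filter.trans
    ⟨fun h => h.2, fun h => ⟨Finset.mem_powerset.2 h.1.1, h⟩⟩

theorem IsMCM.mcmCard_eq {G M : Finset (A × B)} (hM : IsMCM G M) : mcmCard G = M.card :=
  le_antisymm (Finset.sup_le fun N hN => hM.2 N (mem_mcms.1 hN).1)
    (Finset.le_sup (f := Finset.card) (mem_mcms.2 hM))

theorem bottleneckWeight_le {G N : Finset (A × B)} {w : A × B → ℝ} (hN : IsMCM G N) :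
    bottleneckWeight w G ≤ maxWeight w N :=
  Finset.inf_le (mem_mcms.2 hN)

theorem exists_maxWeight_eq (G : Finset (A × B)) (w : A × B → ℝ) :
    ∃ N, IsMCM G N ∧ maxWeight w N = bottleneckWeight w G := by
  obtain ⟨M, hM⟩ := exists_isMCM G
  obtain ⟨N, hN, h⟩ := Finset.exists_mem_eq_inf (mcms G) ⟨M, mem_mcms.2 hM⟩ (maxWeight w)
  exact ⟨N, mem_mcms.1 hN, h.symm⟩

theorem maxWeight_le_iff {w : A × B → ℝ} {M : Finset (A × B)} {x : ℝ} :
    maxWeight w M ≤ x ↔ ∀ f ∈ M, w f ≤ x := by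
  simp [maxWeight, Finset.sup_le_iff]

theorem maxWeight_eq {w : A × B → ℝ} {M : Finset (A × B)} {e : A × B} (he : e ∈ heaviest w M) :
    maxWeight w M = w e := by
  rw [heaviest, Finset.mem_filter] at he
  exact le_antisymm (maxWeight_le_iff.2 he.2)
    (Finset.le_sup (f := fun e => (w e : EReal)) he.1)

theorem heaviest_nonempty {w : A × B → ℝ} {M : Finset (A × B)} (hM : M.Nonempty) :
    (heaviest w M).Nonempty := by
  obtain ⟨e, he, h⟩ := M.exists_max_image w hM
  exact ⟨e, Finset.mem_filter.2 ⟨he, h⟩⟩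

theorem mem_heaviest {w : A × B → ℝ} {M : Finset (A × B)} {e : A × B} :
    e ∈ heaviest w M ↔ e ∈ M ∧ ∀ f ∈ M, w f ≤ w e :=
  Finset.mem_filter

/-- An MCM is a bottleneck assignment if no MCM consists of edges that are lighter than its
heaviest edge. -/
theorem isBottleneckAssignment_of_heaviest {G M : Finset (A × B)} {w : A × B → ℝ} {e : A × B}
    (hM : IsMCM G M) (he : e ∈ heaviest w M)
    (h : ∀ N, IsMCM G N → ∃ f ∈ N, w e ≤ w f) : IsBottleneckAssignment G w M := by
  refine ⟨hM, le_antisymm ?_ (bottleneckWeight_le hM)⟩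
  refine Finset.le_inf fun N hN => ?_
  obtain ⟨f, hf, hef⟩ := h N (mem_mcms.1 hN)
  rw [maxWeight_eq he]
  exact (EReal.coe_le_coe_iff.2 hef).trans (Finset.le_sup (f := fun e => (w e : EReal)) hf)

/-! ### Level minimal matchings -/

/-- `C` is an MCM such that every MCM whose edges beyond a level `x` (in the sense of `r`) belong
to `C` contains all edges of `C` of weight at least `x`. -/
def IsLevelMinimal (r : ℝ → ℝ → Prop) (E : Finset (A × B)) (w : A × B → ℝ)
    (C : Finset (A × B)) : Prop :=
  IsMCM E C ∧ ∀ N, IsMCM E N → ∀ x, (∀ f ∈ N, r x (w f) → f ∈ C) → ∀ c ∈ C, x ≤ w c → c ∈ N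

/-- The relation `r` lies between `<` and `≤`. -/
def IsLevelRel (r : ℝ → ℝ → Prop) : Prop :=
  ∀ x y, (x < y → r x y) ∧ (r x y → x ≤ y)

theorem isLevelRel_le : IsLevelRel (· ≤ ·) := fun _ _ => ⟨le_of_lt, id⟩

theorem isLevelRel_lt : IsLevelRel (· < ·) := fun _ _ => ⟨id, le_of_lt⟩

theorem IsLevelMinimal.le {r : ℝ → ℝ → Prop} (hr : IsLevelRel r) {E C : Finset (A × B)}
    {w : A × B → ℝ} (h : IsLevelMinimal r E w C) : IsLevelMinimal (· ≤ ·) E w C :=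
  ⟨h.1, fun N hN x hx => h.2 N hN x fun f hf hxf => hx f hf ((hr _ _).2 hxf)⟩

theorem IsLevelMinimal.exists_le {r : ℝ → ℝ → Prop} (hr : IsLevelRel r) {E C N : Finset (A × B)}
    {w : A × B → ℝ} (h : IsLevelMinimal r E w C) (hN : IsMCM E N) {c : A × B} (hc : c ∈ C) :
    ∃ f ∈ N, w c ≤ w f := by
  by_contra! hlt
  exact lt_irrefl _ (hlt c ((h.le hr).2 N hN (w c)
    (fun f hf hcf => absurd (hlt f hf) (not_lt.2 hcf)) c hc le_rfl))

/-- A finite set can be enumerated greedily. -/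
theorem exists_enumeration {α : Type*} [DecidableEq α] (C : Finset α) (P : Finset α → α → Prop)
    (h : ∀ D ⊂ C, ∃ e ∈ C \ D, P D e) :
    ∃ e : Fin C.card → α, Set.range e = (C : Set α) ∧
      ∀ k, P ((Finset.univ.filter (· < k)).image e) (e k) := by
  rcases C.eq_empty_or_nonempty with rfl | ⟨c₀, -⟩
  · exact ⟨fun k => k.elim0, by simp, fun k => k.elim0⟩
  -- The default `c₀` outside the proper subsets of `C` makes the choice total, so that it can be
  -- iterated.
  have h' : ∀ D, ∃ e, D ⊂ C → e ∈ C \ D ∧ P D e := fun D => by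
    by_cases hD : D ⊂ C
    · obtain ⟨e, he⟩ := h D hD
      exact ⟨e, fun _ => he⟩
    · exact ⟨c₀, fun h => absurd h hD⟩
  choose nxt hnxt using h'
  let D : ℕ → Finset α := fun n => Nat.rec ∅ (fun _ D => insert (nxt D) D) n
  have hD1 : ∀ n, D (n + 1) = insert (nxt (D n)) (D n) := fun n => rfl
  have hss : ∀ n < C.card, D n ⊆ C → (D n).card = n → D n ⊂ C := fun n hn h1 h2 =>
    h1.ssubset_of_ne fun h => by rw [h] at h2; omega
  have hD : ∀ n ≤ C.card, D n ⊆ C ∧ (D n).card = n := by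
    intro n
    induction n with
    | zero => exact fun _ => ⟨Finset.empty_subset _, rfl⟩
    | succ n ih =>
      intro hn
      obtain ⟨h1, h2⟩ := ih (by omega)
      have h3 := (hnxt _ (hss n hn h1 h2)).1
      rw [Finset.mem_sdiff] at h3
      rw [hD1]
      exact ⟨Finset.insert_subset h3.1 h1, by rw [Finset.card_insert_of_notMem h3.2, h2]⟩
  have himg : ∀ n, D n = (Finset.range n).image (fun m => nxt (D m)) := by
    intro n
    induction n with
    | zero => rfl
    | succ n ih => rw [hD1, Finset.range_add_one, Finset.image_insert, ← ih]
  refine ⟨fun k => nxt (D k), ?_, fun k => ?_⟩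
  · have hC : D C.card = C :=
      Finset.eq_of_subset_of_card_le (hD _ le_rfl).1 (hD _ le_rfl).2.ge
    ext c
    have hc : c ∈ C ↔ c ∈ D C.card := by rw [hC]
    rw [Finset.mem_coe, hc, himg, Finset.mem_image]
    constructor
    · rintro ⟨k, rfl⟩
      exact ⟨k, by simp, rfl⟩
    · rintro ⟨m, hm, rfl⟩
      exact ⟨⟨m, by simpa using hm⟩, rfl⟩
  · have hk : ((Finset.univ.filter (· < k)).image fun k : Fin C.card => nxt (D k)) = D k := by
      rw [himg k]
      ext c
      simp only [Finset.mem_image, Finset.mem_filter, Finset.mem_univ, true_and,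
        Finset.mem_range]
      constructor
      · rintro ⟨m, hm, rfl⟩
        exact ⟨m, hm, rfl⟩
      · rintro ⟨m, hm, rfl⟩
        exact ⟨⟨m, hm.trans k.2⟩, hm, rfl⟩
    rw [hk]
    have := hD k k.2.le
    exact (hnxt _ (hss k k.2 this.1 this.2)).2

theorem residual_eq_minus {n : ℕ} (E : Finset (A × B)) (e : Fin n → A × B) (k : Fin n) :
    residual E e k = minus E ((Finset.univ.filter (· < k)).image e) := by
  ext f
  simp [residual, mem_minus]

/-- If an MCM `N` of the rest were lighter throughout than a heaviest `e` in `C \ D`, then `N ∪ D`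
would have only edges of `D` at or above the level of `e`, yet would have to contain `e`. -/
theorem IsLevelMinimal.isBottleneckAssignment {E C D : Finset (A × B)} {w : A × B → ℝ}
    (h : IsLevelMinimal (· ≤ ·) E w C) (hD : D ⊂ C) :
    IsBottleneckAssignment (minus E D) w (C \ D) := by
  obtain ⟨e, he⟩ := heaviest_nonempty (w := w) (Finset.sdiff_nonempty.2 hD.2)
  refine isBottleneckAssignment_of_heaviest (h.1.sdiff hD.1) he fun N hN => ?_
  by_contra! hlt
  have heC := Finset.mem_sdiff.1 (mem_heaviest.1 he).1
  have := h.2 (N ∪ D) (h.1.union hD.1 hN) (w e) (fun f hf hef => ?_) e heC.1 le_rfl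
  · rcases Finset.mem_union.1 this with h1 | h1
    · exact lt_irrefl _ (hlt e h1)
    · exact heC.2 h1
  · rcases Finset.mem_union.1 hf with h1 | h1
    · exact absurd hef (not_le.2 (hlt f h1))
    · exact hD.1 h1

theorem IsLevelMinimal.isSeqBAP {E C : Finset (A × B)} {w : A × B → ℝ}
    (h : IsLevelMinimal (· ≤ ·) E w C) : IsSeqBAP E w C := by
  obtain ⟨e, he, hP⟩ := exists_enumeration C (fun D e => e ∈ heaviest w (C \ D) ∧
      IsBottleneckAssignment (minus E D) w (C \ D) ∧
      ∀ f ∈ heaviest w (C \ D), price (minus E D) w f ≤ price (minus E D) w e) (fun D hD => by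
    obtain ⟨e, he, hmax⟩ := (heaviest w (C \ D)).exists_max_image (price (minus E D) w)
      (heaviest_nonempty (Finset.sdiff_nonempty.2 hD.2))
    exact ⟨e, (mem_heaviest.1 he).1, he, h.isBottleneckAssignment hD, hmax⟩)
  refine ⟨h.1, e, he, fun k => ?_⟩
  obtain ⟨h1, h2, h3⟩ := hP k
  rw [residual_eq_minus]
  exact ⟨_, h2, h1, h3⟩

/-! ### Strictly level minimal matchings -/

/-- A bottleneck assignment avoiding `e` survives the removal of `e`. Finiteness of its weight
matters: in `EReal` an infinite value minus itself is not zero. -/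
theorem price_eq_zero {G N : Finset (A × B)} {w : A × B → ℝ} {e : A × B}
    (hN : IsMCM G N) (he : e ∉ N) (hw : maxWeight w N = bottleneckWeight w G) {x : ℝ}
    (hx : maxWeight w N = x) : price G w e = 0 := by
  have hN' : IsMCM (G.erase e) N :=
    hN.of_subset (Finset.erase_subset _ _) (Finset.subset_erase.2 ⟨hN.1.1, he⟩)
  have h1 : bottleneckWeight w (G.erase e) = bottleneckWeight w G := by
    refine le_antisymm (hw ▸ bottleneckWeight_le hN') ?_
    obtain ⟨N', h1, h2⟩ := exists_maxWeight_eq (G.erase e) w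
    rw [← h2]
    exact bottleneckWeight_le (hN.mono (Finset.erase_subset _ _) hN'.1.1 h1)
  rw [price, if_pos (by rw [hN.mcmCard_eq, hN'.mcmCard_eq]), h1, ← hw, hx, ← EReal.coe_sub]
  simp

/-- Without `c`, either the MCMs become smaller and the price is infinite, or each of them has an
edge heavier than `x`. -/
theorem price_pos {G M : Finset (A × B)} {w : A × B → ℝ} {c : A × B}
    (hM : IsMCM G M) {x : ℝ} (hx : bottleneckWeight w G = x) (hne : M.Nonempty)
    (h : ∀ N, IsMCM G N → (∀ f ∈ N, w f ≤ x) → c ∈ N) : 0 < price G w c := by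
  rw [price]
  split_ifs with hc
  · obtain ⟨N, hN, hw⟩ := exists_maxWeight_eq (G.erase c) w
    have hcard : N.card = M.card := by rw [← hN.mcmCard_eq, hc, hM.mcmCard_eq]
    have hNG : IsMCM G N := hM.of_card (hN.1.mono (Finset.erase_subset _ _)) hcard.ge
    have hNne : N.Nonempty := by
      rw [← Finset.card_pos, hcard]
      exact hne.card_pos
    obtain ⟨e, he⟩ := heaviest_nonempty (w := w) hNne
    have hlt : x < w e := by
      by_contra! hle
      exact Finset.notMem_erase c G (hN.1.1 (h N hNG fun f hf =>
        ((mem_heaviest.1 he).2 f hf).trans hle))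
    rw [← hw, maxWeight_eq he, hx, ← EReal.coe_sub]
    exact_mod_cast sub_pos.2 hlt
  · exact EReal.zero_lt_top

theorem IsLevelMinimal.eq_of_isSeqBAP {E C M : Finset (A × B)} {w : A × B → ℝ}
    (h : IsLevelMinimal (· < ·) E w C) (hM : IsSeqBAP E w M) : M = C := by
  obtain ⟨hM, e, he, hk⟩ := hM
  refine Finset.eq_of_subset_of_card_le ?_ (hM.card_eq h.1).ge
  by_contra hsub
  have hex : ∃ k, e k ∉ C := by
    by_contra! hall
    refine hsub fun f hf => ?_
    rw [← Finset.mem_coe, ← he] at hf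
    obtain ⟨k, rfl⟩ := hf
    exact hall k
  obtain ⟨k, hkC, hmin⟩ : ∃ k, e k ∉ C ∧ ∀ m < k, e m ∈ C := by
    obtain ⟨k, hk1, hk2⟩ := WellFounded.has_min (wellFounded_lt (α := Fin M.card))
      -- At the first edge outside `C`, the set removed before it lies in `C`.
      {k | e k ∉ C} hex
    exact ⟨k, hk1, fun m hm => by_contra fun h => hk2 m h hm⟩
  obtain ⟨Mk, ⟨hMk, hbot⟩, heM, hprice⟩ := hk k
  rw [residual_eq_minus] at hMk hbot hprice
  set D := (Finset.univ.filter (· < k)).image e with hD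
  have hDC : D ⊆ C := by
    intro f hf
    obtain ⟨m, hm, rfl⟩ := Finset.mem_image.1 hf
    exact hmin m (Finset.mem_filter.1 hm).2
  -- Here the strict relation is needed: `N` may have edges of weight exactly `w (e k)` outside `C`.
  have hin : ∀ N, IsMCM (minus E D) N → (∀ f ∈ N, w f ≤ w (e k)) →
      ∀ c ∈ C \ D, w (e k) ≤ w c → c ∈ N := by
    intro N hN hle c hc hkc
    rw [Finset.mem_sdiff] at hc
    have := h.2 (N ∪ D) (h.1.union hDC hN) (w (e k)) (fun f hf hlt => ?_) c hc.1 hkc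
    · exact (Finset.mem_union.1 this).resolve_right hc.2
    · rcases Finset.mem_union.1 hf with hf | hf
      · exact absurd (hle f hf) (not_le.2 hlt)
      · exact hDC hf
  have hCD := h.1.sdiff hDC
  have hMkle := (mem_heaviest.1 heM).2
  have hwk : bottleneckWeight w (minus E D) = w (e k) := by rw [← hbot, maxWeight_eq heM]
  have hCDle : ∀ c ∈ C \ D, w c ≤ w (e k) := by
    intro c hc
    by_contra! hlt
    exact absurd (hMkle c (hin Mk hMk hMkle c hc hlt.le)) (not_le.2 hlt)
  have hCDmax : maxWeight w (C \ D) = w (e k) :=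
    le_antisymm (maxWeight_le_iff.2 hCDle) (hwk ▸ bottleneckWeight_le hCD)
  have hne : (C \ D).Nonempty := by
    rw [← Finset.card_pos, hCD.card_eq hMk]
    exact Finset.card_pos.2 ⟨_, (mem_heaviest.1 heM).1⟩
  obtain ⟨c, hc⟩ := heaviest_nonempty (w := w) hne
  have hwc : w c = w (e k) := by
    rw [maxWeight_eq hc] at hCDmax
    exact_mod_cast hCDmax
  have hcCD := (mem_heaviest.1 hc).1
  have hcMk : c ∈ heaviest w Mk :=
    mem_heaviest.2 ⟨hin Mk hMk hMkle c hcCD hwc.ge, fun f hf => hwc ▸ hMkle f hf⟩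
  have h0 : price (minus E D) w (e k) = 0 :=
    price_eq_zero hCD (fun h => hkC (Finset.mem_sdiff.1 h).1) (hCDmax.trans hwk.symm) hCDmax
  have h1 : 0 < price (minus E D) w c :=
    price_pos hCD hwk hne fun N hN hle => hin N hN hle c hcCD hwc.ge
  exact absurd (hprice c hcMk) (not_le.2 (h0 ▸ h1))

/-! ### Sorted weights and the lexicographic order -/

theorem sortedWeights_union {w : A × B → ℝ} {M X : Finset (A × B)} (hd : Disjoint M X)
    (h : ∀ e ∈ M, ∀ f ∈ X, w f ≤ w e) :
    sortedWeights w (M ∪ X) = sortedWeights w M ++ sortedWeights w X := by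
  refine List.Perm.eq_of_pairwise (le := fun x y : ℝ => y ≤ x)
    (fun a b _ _ h1 h2 => le_antisymm h2 h1) (Multiset.pairwise_sort _ _) ?_ ?_
  · rw [List.pairwise_append]
    refine ⟨Multiset.pairwise_sort _ _, Multiset.pairwise_sort _ _, ?_⟩
    intro a ha b hb
    rw [sortedWeights, Multiset.mem_sort, Multiset.mem_map] at ha hb
    obtain ⟨e, he, rfl⟩ := ha
    obtain ⟨f, hf, rfl⟩ := hb
    exact h e he f hf
  · rw [← Multiset.coe_eq_coe, ← Multiset.coe_add]
    simp only [sortedWeights, Multiset.sort_eq]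
    rw [← Multiset.map_add, ← Finset.disjUnion_eq_union _ _ hd]
    rfl

theorem sortedWeights_getD_zero {w : A × B → ℝ} {X : Finset (A × B)} (hX : X.Nonempty) :
    ∃ e ∈ heaviest w X, (sortedWeights w X).getD 0 0 = w e := by
  have hmem : ∀ x, x ∈ sortedWeights w X ↔ ∃ e ∈ X, w e = x := by
    intro x
    rw [sortedWeights, Multiset.mem_sort, Multiset.mem_map]
    rfl
  have hsort : (sortedWeights w X).Pairwise (fun x y => y ≤ x) := Multiset.pairwise_sort _ _
  cases hl : sortedWeights w X with
  | nil =>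
    obtain ⟨e, he⟩ := hX
    have := (hmem (w e)).2 ⟨e, he, rfl⟩
    simp [hl] at this
  | cons a l =>
    obtain ⟨e, he, rfl⟩ := (hmem a).1 (by simp [hl])
    refine ⟨e, mem_heaviest.2 ⟨he, fun f hf => ?_⟩, by simp⟩
    have := (hmem (w f)).2 ⟨f, hf, rfl⟩
    rw [hl] at this hsort
    rcases List.mem_cons.1 this with h | h
    · exact h.le
    · exact (List.pairwise_cons.1 hsort).1 _ h

/-- The list `s` precedes `t` lexicographically, with the first difference before index `n`. -/
def LexBefore (n : ℕ) (s t : List ℝ) : Prop :=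
  ∃ k < n, s.getD k 0 < t.getD k 0 ∧ ∀ l < k, s.getD l 0 = t.getD l 0

theorem LexBefore.ne {n : ℕ} {s t : List ℝ} (h : LexBefore n s t) : t ≠ s := by
  obtain ⟨k, -, h, -⟩ := h
  rintro rfl
  exact lt_irrefl _ h

theorem LexBefore.asymm {n m : ℕ} {s t : List ℝ} (h : LexBefore n s t) : ¬ LexBefore m t s := by
  obtain ⟨k, -, h1, h2⟩ := h
  rintro ⟨l, -, h3, h4⟩
  rcases lt_trichotomy k l with h | rfl | h
  · exact h1.ne (h4 k h).symm
  · exact lt_asymm h1 h3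
  · exact h3.ne (h2 l h).symm

theorem length_sortedWeights (w : A × B → ℝ) (M : Finset (A × B)) :
    (sortedWeights w M).length = M.card := by
  simp [sortedWeights]

/-- Both sorted lists begin with the weights of the edges of `C` at level `x` or above. The next
entry is below `x` for `C` and, because of `f₀`, at least `x` for `N`. -/
theorem lexBefore_sortedWeights {C N : Finset (A × B)} {w : A × B → ℝ} {x : ℝ}
    (hcard : C.card = N.card) (hsub : C.filter (fun f => x ≤ w f) ⊆ N) {f₀ : A × B}
    (hf₀ : f₀ ∈ N \ C.filter (fun f => x ≤ w f)) (hx : x ≤ w f₀)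
    (hle : ∀ f ∈ N \ C.filter (fun f => x ≤ w f), w f ≤ x) :
    LexBefore C.card (sortedWeights w C) (sortedWeights w N) := by
  set L := C.filter (fun f => x ≤ w f) with hL
  have hLC : L ⊆ C := Finset.filter_subset _ _
  have hLx : ∀ e ∈ L, x ≤ w e := fun e he => (Finset.mem_filter.1 he).2
  have hCL : ∀ f ∈ C \ L, w f < x := by
    intro f hf
    rw [Finset.mem_sdiff, hL, Finset.mem_filter, not_and, not_le] at hf
    exact hf.2 hf.1
  have hlt : L.card < C.card := by
    rw [hcard]
    exact Finset.card_lt_card ⟨hsub, fun h => (Finset.mem_sdiff.1 hf₀).2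
      (h (Finset.mem_sdiff.1 hf₀).1)⟩
  have hC : sortedWeights w C = sortedWeights w L ++ sortedWeights w (C \ L) := by
    rw [← sortedWeights_union Finset.disjoint_sdiff
      (fun e he f hf => (hCL f hf).le.trans (hLx e he)), Finset.union_sdiff_of_subset hLC]
  have hN : sortedWeights w N = sortedWeights w L ++ sortedWeights w (N \ L) := by
    rw [← sortedWeights_union Finset.disjoint_sdiff
      (fun e he f hf => (hle f hf).trans (hLx e he)), Finset.union_sdiff_of_subset hsub]
  have hlen := length_sortedWeights w L
  refine ⟨L.card, hlt, ?_, fun l hl => ?_⟩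
  · rw [hC, hN, List.getD_append_right _ _ _ _ hlen.le, List.getD_append_right _ _ _ _ hlen.le,
      hlen, Nat.sub_self]
    obtain ⟨e, he, h1⟩ := sortedWeights_getD_zero (w := w) (X := C \ L) (by
      rw [← Finset.card_pos, Finset.card_sdiff_of_subset hLC]
      omega)
    obtain ⟨f, hf, h2⟩ := sortedWeights_getD_zero (w := w) (X := N \ L) ⟨f₀, hf₀⟩
    rw [h1, h2]
    exact (hCL e (mem_heaviest.1 he).1).trans_le (hx.trans ((mem_heaviest.1 hf).2 f₀ hf₀))
  · rw [hC, hN, List.getD_append _ _ _ _ (hlen ▸ hl), List.getD_append _ _ _ _ (hlen ▸ hl)]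

theorem IsLevelMinimal.lexBefore {E C N : Finset (A × B)} {w : A × B → ℝ}
    (h : IsLevelMinimal (· < ·) E w C) (hN : IsMCM E N) (hne : N ≠ C) :
    LexBefore C.card (sortedWeights w C) (sortedWeights w N) := by
  have hcard := h.1.card_eq hN
  have hsd : ((N \ C) ∪ (C \ N)).Nonempty := by
    rw [Finset.nonempty_iff_ne_empty]
    intro h0
    rw [Finset.union_eq_empty, Finset.sdiff_eq_empty_iff_subset,
      Finset.sdiff_eq_empty_iff_subset] at h0
    exact hne (h0.1.antisymm h0.2)
  -- Above the level of a heaviest edge of the symmetric difference the two matchings agree, so the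
  -- strong form of level minimality applies there and forces `f₀` into `N`.
  obtain ⟨f₀, hf₀, hmax⟩ := Finset.exists_max_image _ w hsd
  have hC : ∀ c ∈ C, w f₀ ≤ w c → c ∈ N := h.2 N hN (w f₀) fun f hf hlt => by
    by_contra hfC
    exact absurd (hmax f (Finset.mem_union_left _ (Finset.mem_sdiff.2 ⟨hf, hfC⟩)))
      (not_le.2 hlt)
  have hf₀N : f₀ ∈ N ∧ f₀ ∉ C := by
    rcases Finset.mem_union.1 hf₀ with h1 | h1 <;> rw [Finset.mem_sdiff] at h1
    · exact h1
    · exact absurd (hC f₀ h1.1 le_rfl) h1.2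
  refine lexBefore_sortedWeights hcard (x := w f₀) (f₀ := f₀) ?_ ?_ le_rfl ?_
  · intro c hc
    rw [Finset.mem_filter] at hc
    exact hC c hc.1 hc.2
  · exact Finset.mem_sdiff.2 ⟨hf₀N.1, fun h => hf₀N.2 (Finset.mem_filter.1 h).1⟩
  · intro f hf
    rw [Finset.mem_sdiff, Finset.mem_filter, not_and, not_le] at hf
    by_cases hfC : f ∈ C
    · exact (hf.2 hfC).le
    · exact hmax f (Finset.mem_union_left _ (Finset.mem_sdiff.2 ⟨hf.1, hfC⟩))

theorem IsLevelMinimal.isLexBAP {E C : Finset (A × B)} {w : A × B → ℝ}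
    (h : IsLevelMinimal (· < ·) E w C) : IsLexBAP E w C :=
  ⟨h.1, fun _ hM hne => h.lexBefore hM fun h' => hne (by rw [h'])⟩

theorem IsLevelMinimal.eq_of_isLexBAP {E C M : Finset (A × B)} {w : A × B → ℝ}
    (h : IsLevelMinimal (· < ·) E w C) (hM : IsLexBAP E w M) : M = C := by
  by_contra hne
  have h1 := h.lexBefore hM.1 hne
  exact h1.asymm (hM.2 C h.1 h1.ne.symm)

/-! ### Extending level minimal matchings -/

theorem minus_empty (G : Finset (A × B)) : minus G ∅ = G := by
  ext f
  simp [mem_minus]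

/-- A competitor `N` stays inside `G₁`: at or above the level `x` its edges lie in `S ∪ D`, and
below it they are lighter than some edge of `M`. Hence it contains `D`, and the minimality of `S`
applies to `N \ D`. With `<` the argument fails, since edges of weight exactly `x` may have been
pruned. -/
theorem IsLevelMinimal.union_of_light {G G₁ M D S : Finset (A × B)} {w : A × B → ℝ}
    (hM : IsMCM G M) (hD : D ⊆ M) (hM₁ : M ⊆ G₁) (hG₁ : G₁ ⊆ G)
    (hlight : ∀ f ∈ G, ∀ c ∈ M, w f < w c → f ∈ G₁)
    (hall : ∀ N, IsMCM G N → N ⊆ G₁ → D ⊆ N)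
    (hS : IsLevelMinimal (· ≤ ·) (minus G₁ D) w S) : IsLevelMinimal (· ≤ ·) G w (S ∪ D) := by
  have hM' : IsMCM G₁ M := hM.of_subset hG₁ hM₁
  have hSD : IsMCM G₁ (S ∪ D) := hM'.union hD hS.1
  refine ⟨hM.mono hG₁ hM₁ hSD, fun N hN x hx c hc hxc => ?_⟩
  obtain ⟨c', hc', hcc'⟩ : ∃ c' ∈ M, w c ≤ w c' := by
    rcases Finset.mem_union.1 hc with h | h
    · obtain ⟨c', h1, h2⟩ := hS.exists_le isLevelRel_le (hM'.sdiff hD) h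
      exact ⟨c', (Finset.mem_sdiff.1 h1).1, h2⟩
    · exact ⟨c, hD h, le_rfl⟩
  have hNG : N ⊆ G₁ := by
    intro f hf
    by_cases h : x ≤ w f
    · exact hSD.1.1 (hx f hf h)
    · exact hlight f (hN.1.1 hf) c' hc' ((not_le.1 h).trans_le (hxc.trans hcc'))
  have hDN := hall N hN hNG
  rcases Finset.mem_union.1 hc with h | h
  · refine (Finset.mem_sdiff.1 (hS.2 (N \ D) ((hN.of_subset hG₁ hNG).sdiff hDN) x
      (fun f hf hxf => ?_) c h hxc)).1
    rw [Finset.mem_sdiff] at hf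
    exact (Finset.mem_union.1 (hx f hf.1 hxf)).resolve_right hf.2
  · exact hDN h

/-- As nothing is pruned here, it is enough that the competitor is nowhere heavier than the maximum
of `M`. This holds for both relations. -/
theorem IsLevelMinimal.union {r : ℝ → ℝ → Prop} (hr : IsLevelRel r) {G M D S : Finset (A × B)}
    {w : A × B → ℝ} (hM : IsMCM G M) (hD : D ⊆ M)
    (hall : ∀ N, IsMCM G N → (∀ f ∈ N, ∃ c ∈ M, w f ≤ w c) → D ⊆ N)
    (hS : IsLevelMinimal r (minus G D) w S) : IsLevelMinimal r G w (S ∪ D) := by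
  have hbound : ∀ c ∈ S ∪ D, ∃ c' ∈ M, w c ≤ w c' := by
    intro c hc
    rcases Finset.mem_union.1 hc with h | h
    · obtain ⟨c', h1, h2⟩ := hS.exists_le hr (hM.sdiff hD) h
      exact ⟨c', (Finset.mem_sdiff.1 h1).1, h2⟩
    · exact ⟨c, hD h, le_rfl⟩
  refine ⟨hM.union hD hS.1, fun N hN x hx c hc hxc => ?_⟩
  have hDN : D ⊆ N := hall N hN fun f hf => by
    by_cases h : r x (w f)
    · exact hbound f (hx f hf h)
    · obtain ⟨c', h1, h2⟩ := hbound c hc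
      exact ⟨c', h1, (not_lt.1 fun h' => h ((hr _ _).1 h')).trans (hxc.trans h2)⟩
  rcases Finset.mem_union.1 hc with h | h
  · refine (Finset.mem_sdiff.1 (hS.2 (N \ D) (hN.sdiff hDN) x
      (fun f hf hxf => ?_) c h hxc)).1
    rw [Finset.mem_sdiff] at hf
    exact (Finset.mem_union.1 (hx f hf.1 hxf)).resolve_right hf.2
  · exact hDN h

/-- An MCM in `F` avoiding `e` would exceed `M.erase e` inside `F.erase e`, and Berge's lemma would
give an augmenting path. -/
theorem mem_of_not_hasAugPath {G F M N : Finset (A × B)} {e : A × B} (hM : IsMCM G M)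
    (hN : IsMCM G N) (he : e ∈ M) (hMF : M ⊆ F) (hNF : N ⊆ F)
    (h : ¬ HasAugPath (F.erase e) (M.erase e)) : e ∈ N := by
  by_contra heN
  refine h (hasAugPath_of_card_lt (N' := N)
    ⟨Finset.erase_subset_erase _ hMF, (hM.1.subset (Finset.erase_subset _ _)).2⟩
    ⟨Finset.subset_erase.2 ⟨hNF, heN⟩, hN.1.2⟩ ?_)
  rw [hN.card_eq hM]
  exact Finset.card_erase_lt_of_mem he

theorem exists_isMCM_of_hasAugPath {G F M : Finset (A × B)} {e : A × B} (hM : IsMCM G M)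
    (he : e ∈ M) (hMF : M ⊆ F) (hF : F ⊆ G) (h : HasAugPath (F.erase e) (M.erase e)) :
    ∃ N, IsMCM G N ∧ N ⊆ F.erase e := by
  obtain ⟨N, hN, hlt⟩ := h.exists_larger
    ⟨Finset.erase_subset_erase _ hMF, (hM.1.subset (Finset.erase_subset _ _)).2⟩
  rw [Finset.card_erase_of_mem he] at hlt
  exact ⟨N, hM.of_card (hN.mono ((Finset.erase_subset _ _).trans hF)) (by omega), hN.1⟩

/-! ### The algorithm -/

variable {test : PriceTest} {E : Finset (A × B)} {w : A × B → ℝ} {s s' : State A B}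

theorem cur_subset_shrunk : s.cur ⊆ s.shrunk w :=
  Finset.subset_union_left

theorem positiveEdges_subset (w : A × B → ℝ) (T M : Finset (A × B)) : positiveEdges w T M ⊆ M :=
  Finset.filter_subset _ _

theorem selected_subset_cur {e : A × B} (he : e ∈ s.cur) : s.selected test E w e ⊆ s.cur := by
  rw [State.selected]
  split_ifs
  · exact Finset.insert_subset he (positiveEdges_subset _ _ _)
  · exact positiveEdges_subset _ _ _

theorem selected_nonempty (e : A × B) : (s.selected test E w e).Nonempty := by
  rw [State.selected]
  split_ifs with h
  · exact Finset.insert_nonempty _ _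
  · exact (Finset.nonempty_iff_ne_empty.2 h).mono Finset.inter_subset_left

theorem mem_shrunk_le {e : A × B} (he : e ∈ heaviest w s.cur) {f : A × B} (hf : f ∈ s.shrunk w) :
    w f ≤ w e := by
  rcases Finset.mem_union.1 hf with h | h
  · exact (mem_heaviest.1 he).2 f h
  · obtain ⟨-, g, hg, hlt⟩ := Finset.mem_filter.1 h
    exact hlt.le.trans ((mem_heaviest.1 he).2 g hg)

/-- The termination measure. An improvement excludes `e`: the new matching avoids it and has no edge
heavier than it. A locking iteration removes at least one selected edge. -/
theorem Step.card_shrunk_lt (h : Step test E w s s') :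
    (s'.shrunk w).card < (s.shrunk w).card := by
  cases h with
  | improve e R he hR hne =>
    have hRsub : R ⊆ (s.shrunk w).erase e := by
      rcases hR with ⟨-, -, h⟩ | ⟨-, h⟩
      · exact h
      · exact absurd h hne
    refine (Finset.card_le_card (Finset.union_subset hRsub fun f hf => ?_)).trans_lt
      (Finset.card_erase_lt_of_mem (cur_subset_shrunk (mem_heaviest.1 he).1))
    obtain ⟨h1, g, hg, hlt⟩ := Finset.mem_filter.1 hf
    refine Finset.mem_erase.2 ⟨?_, h1⟩
    rintro rfl
    exact absurd (mem_shrunk_le he (Finset.mem_of_mem_erase (hRsub hg))) (not_le.2 hlt)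
  | critical e R he hR heq =>
    obtain ⟨x, hx⟩ := selected_nonempty (s := s) (test := test) (E := E) (w := w) e
    refine (Finset.card_le_card (Finset.union_subset ?_ ?_)).trans_lt (Finset.card_erase_lt_of_mem
      (cur_subset_shrunk (selected_subset_cur (mem_heaviest.1 he).1 hx)))
    · intro f hf
      have h1 := Finset.mem_sdiff.1 hf
      refine Finset.mem_erase.2 ⟨?_, cur_subset_shrunk h1.1⟩
      rintro rfl
      exact h1.2 hx
    · intro f hf
      obtain ⟨h1, h2, -⟩ := Finset.mem_filter.1 (Finset.mem_filter.1 hf).1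
      refine Finset.mem_erase.2 ⟨?_, h1⟩
      rintro rfl
      exact (Finset.mem_sdiff.1 h2).2 (Finset.mem_image_of_mem _ hx)

/-- Properties of the states that are preserved by the steps of the algorithm. -/
structure Invariant (E : Finset (A × B)) (w : A × B → ℝ) (s : State A B) : Prop where
  cur_subset : s.cur ⊆ s.edges
  edges_subset : s.edges ⊆ testEdges .full E s
  isMCM : IsMCM (testEdges .full E s) s.cur
  light : ∀ f ∈ testEdges .full E s, ∀ c ∈ s.cur, w f < w c → f ∈ s.edges
  chosen_agents : ∀ c ∈ s.chosen, c.1 ∉ s.agents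
  extend : ∀ S, IsLevelMinimal (· ≤ ·) s.edges w S →
    IsLevelMinimal (· ≤ ·) E w (s.chosen ∪ S)

theorem mem_testEdges_full {f : A × B} :
    f ∈ testEdges .full E s ↔ f ∈ E ∧ f.1 ∈ s.agents ∧ f.2 ∈ s.tasks :=
  Finset.mem_filter

theorem Invariant.start [Fintype A] [Fintype B] {M₀ : Finset (A × B)} (h : IsMCM E M₀) :
    Invariant E w (State.start E M₀) := by
  have hE : testEdges .full E (State.start E M₀) = E := by
    ext f
    simp [mem_testEdges_full, State.start]
  constructor
  · exact h.1.1
  · rw [hE]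
    exact subset_rfl
  · rw [hE]
    exact h
  · rw [hE]
    exact fun f hf _ _ _ => hf
  · intro c hc
    simp [State.start] at hc
  · intro S hS
    simpa [State.start] using hS

theorem Invariant.edges_subset_testEdges (h : Invariant E w s) :
    s.edges ⊆ testEdges test E s := by
  cases test with
  | pruned => exact subset_rfl
  | full => exact h.edges_subset

theorem Invariant.testEdges_subset (h : Invariant E w s) :
    testEdges test E s ⊆ testEdges .full E s := by
  cases test with
  | pruned => exact h.edges_subset
  | full => exact subset_rfl

theorem Invariant.isMCM_testEdges (h : Invariant E w s) (test : PriceTest) :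
    IsMCM (testEdges test E s) s.cur :=
  h.isMCM.of_subset h.testEdges_subset (h.cur_subset.trans h.edges_subset_testEdges)

theorem Invariant.isMCM_edges (h : Invariant E w s) : IsMCM s.edges s.cur :=
  h.isMCM_testEdges .pruned

theorem Invariant.shrunk_subset (h : Invariant E w s) : s.shrunk w ⊆ s.edges :=
  Finset.union_subset h.cur_subset (Finset.filter_subset _ _)

theorem mem_shrunk_of_lt {f c : A × B} (hf : f ∈ s.edges) (hc : c ∈ s.cur) (h : w f < w c) :
    f ∈ s.shrunk w :=
  Finset.mem_union_right _ (Finset.mem_filter.2 ⟨hf, c, hc, h⟩)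

theorem Invariant.positiveEdges_subset (h : Invariant E w s) {N : Finset (A × B)}
    (hN : IsMCM (testEdges test E s) N) (hle : ∀ f ∈ N, ∃ c ∈ s.cur, w f ≤ w c) :
    positiveEdges w (testEdges test E s) s.cur ⊆ N := by
  intro e he
  obtain ⟨h1, h2⟩ := Finset.mem_filter.1 he
  exact mem_of_not_hasAugPath (h.isMCM_testEdges test) hN h1
    (fun f hf => Finset.mem_filter.2 ⟨(h.isMCM_testEdges test).1.1 hf, f, hf, le_rfl⟩)
    (fun f hf => Finset.mem_filter.2 ⟨hN.1.1 hf, hle f hf⟩) h2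

theorem Invariant.selected_subset (h : Invariant E w s) {e : A × B} (he : e ∈ s.cur)
    (haug : ¬ HasAugPath ((s.shrunk w).erase e) (s.cur.erase e)) {N : Finset (A × B)}
    (hN : IsMCM s.edges N) (hNs : N ⊆ s.shrunk w) : s.selected test E w e ⊆ N := by
  have h1 : positiveEdges w (testEdges test E s) s.cur ⊆ N := by
    refine h.positiveEdges_subset ((h.isMCM_testEdges test).mono h.edges_subset_testEdges
      h.cur_subset hN) fun f hf => ?_
    rcases Finset.mem_union.1 (hNs hf) with h | h
    · exact ⟨f, h, le_rfl⟩
    · obtain ⟨-, c, hc, hlt⟩ := Finset.mem_filter.1 h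
      exact ⟨c, hc, hlt.le⟩
  rw [State.selected]
  split_ifs
  · exact Finset.insert_subset
      (mem_of_not_hasAugPath h.isMCM_edges hN he cur_subset_shrunk hNs haug) h1
  · exact h1

theorem mem_remaining_iff {V : Finset A} {V' : Finset B} {X : Finset (A × B)} {f : A × B} :
    (f.1 ∈ V \ X.image Prod.fst ∧ f.2 ∈ V' \ X.image Prod.snd) ↔
      (f.1 ∈ V ∧ f.2 ∈ V') ∧ ∀ d ∈ X, f.1 ≠ d.1 ∧ f.2 ≠ d.2 := by
  simp only [Finset.mem_sdiff, Finset.mem_image, not_exists, not_and]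
  constructor
  · rintro ⟨⟨h1, h2⟩, h3, h4⟩
    exact ⟨⟨h1, h3⟩, fun d hd => ⟨fun h => h2 d hd h.symm, fun h => h4 d hd h.symm⟩⟩
  · rintro ⟨⟨h1, h2⟩, h3⟩
    exact ⟨⟨h1, fun d hd h => (h3 d hd).1 h.symm⟩, h2, fun d hd h => (h3 d hd).2 h.symm⟩

theorem testEdges_lock (e : A × B) :
    testEdges .full E (s.lock test E w e) =
      minus (testEdges .full E s) (s.selected test E w e) := by
  ext f
  rw [mem_testEdges_full, mem_minus, mem_testEdges_full, State.lock, mem_remaining_iff]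
  tauto

theorem Invariant.edges_lock (h : Invariant E w s) (e : A × B) :
    (s.lock test E w e).edges = minus (s.shrunk w) (s.selected test E w e) := by
  ext f
  rw [State.lock, mem_minus, Finset.mem_filter, mem_remaining_iff]
  constructor
  · tauto
  · exact fun hf => ⟨hf.1, (mem_testEdges_full.1 (h.edges_subset (h.shrunk_subset hf.1))).2, hf.2⟩

theorem AugPathResult.of_ne {G N F R : Finset (A × B)} (h : AugPathResult G N F R) (hne : R ≠ N) :
    IsMCM G R ∧ R ⊆ F := by
  rcases h with h | h
  · exact h.2
  · exact absurd h.2 hne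

theorem AugPathResult.not_hasAugPath {G M F : Finset (A × B)} {e : A × B} (hM : IsMCM G M)
    (he : e ∈ M) (h : AugPathResult G (M.erase e) F (M.erase e)) :
    ¬ HasAugPath F (M.erase e) := by
  rcases h with h | h
  · have h1 := h.2.1.card_eq hM
    have h2 := Finset.card_erase_lt_of_mem he
    omega
  · exact h.1

/-- The field `light` ensures that pruning has only removed edges at least as heavy as every edge of
the current matching. The field `extend` passes through `IsLevelMinimal.union_of_light`, with
nothing forced in an improvement and with the selected edges forced in a locking iteration. -/
theorem Invariant.step (h : Invariant E w s) (hs : Step test E w s s') : Invariant E w s' := by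
  cases hs with
  | improve e R he hR hne =>
    obtain ⟨h1, h2⟩ := hR.of_ne hne
    have h3 : R ⊆ s.shrunk w := h2.trans (Finset.erase_subset _ _)
    refine ⟨h3, h.shrunk_subset.trans h.edges_subset,
      h.isMCM.mono h.edges_subset h.cur_subset h1, ?_, h.chosen_agents, ?_⟩
    · intro f hf c hc hlt
      have hlt' := hlt.trans_le (mem_shrunk_le he (h3 hc))
      have he' := (mem_heaviest.1 he).1
      exact mem_shrunk_of_lt (h.light f hf e he' hlt') he' hlt'
    · intro S hS
      refine h.extend S ?_
      have := IsLevelMinimal.union_of_light (G := s.edges) (D := ∅) h.isMCM_edges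
        (Finset.empty_subset _) cur_subset_shrunk h.shrunk_subset
        (fun f hf c hc hlt => mem_shrunk_of_lt hf hc hlt)
        (fun _ _ _ => Finset.empty_subset _) ((minus_empty (s.shrunk w)).symm ▸ hS)
      simpa using this
  | critical e R he hR heq =>
    subst heq
    have hec := (mem_heaviest.1 he).1
    have haug := hR.not_hasAugPath h.isMCM_edges hec
    have hX := selected_subset_cur (test := test) (E := E) (w := w) hec
    have hedges := h.edges_lock (test := test) e
    have hsub : s.cur \ s.selected test E w e ⊆ minus (s.shrunk w) (s.selected test E w e) :=
      ((h.isMCM.of_subset (h.shrunk_subset.trans h.edges_subset) cur_subset_shrunk).sdiff hX).1.1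
    constructor
    · rw [hedges]
      exact hsub
    · rw [hedges, testEdges_lock]
      exact Finset.filter_subset_filter _ (h.shrunk_subset.trans h.edges_subset)
    · rw [testEdges_lock]
      exact h.isMCM.sdiff hX
    · rw [hedges, testEdges_lock]
      intro f hf c hc hlt
      have hc' := (Finset.mem_sdiff.1 hc).1
      rw [mem_minus] at hf ⊢
      exact ⟨mem_shrunk_of_lt (h.light f hf.1 c hc' hlt) hc' hlt, hf.2⟩
    · intro c hc hca
      rw [State.lock, Finset.mem_sdiff] at hca
      rcases Finset.mem_union.1 hc with h1 | h1
      · exact h.chosen_agents c h1 hca.1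
      · exact hca.2 (Finset.mem_image_of_mem _ h1)
    · intro S hS
      rw [hedges] at hS
      have := h.extend _ (IsLevelMinimal.union_of_light h.isMCM_edges hX cur_subset_shrunk
        h.shrunk_subset (fun f hf c hc hlt => mem_shrunk_of_lt hf hc hlt)
        (fun N hN hNs => h.selected_subset hec haug hN hNs) hS)
      rwa [Finset.union_comm S, ← Finset.union_assoc] at this

/-! ### Progress and termination of the loop -/

theorem Invariant.exists_step (h : Invariant E w s) (hne : s.cur.Nonempty) (test : PriceTest) :
    ∃ s', Step test E w s s' := by
  obtain ⟨e, he⟩ := heaviest_nonempty (w := w) hne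
  have hec := (mem_heaviest.1 he).1
  by_cases haug : HasAugPath ((s.shrunk w).erase e) (s.cur.erase e)
  · obtain ⟨N, hN, hNs⟩ := exists_isMCM_of_hasAugPath h.isMCM_edges hec cur_subset_shrunk
      h.shrunk_subset haug
    refine ⟨_, Step.improve s e N he (Or.inl ⟨haug, hN, hNs⟩) ?_⟩
    rintro rfl
    have h1 := hN.card_eq h.isMCM_edges
    have h2 := Finset.card_erase_lt_of_mem hec
    omega
  · exact ⟨_, Step.critical s e _ he (Or.inr ⟨haug, rfl⟩) rfl⟩

theorem Invariant.of_reachable (h : Invariant E w s)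
    (hs : Relation.ReflTransGen (Step test E w) s s') : Invariant E w s' := by
  induction hs with
  | refl => exact h
  | tail _ hs ih => exact ih.step hs

theorem not_exists_infinite_run :
    ¬ ∃ S : ℕ → State A B, ∀ t, Step test E w (S t) (S (t + 1)) := by
  rintro ⟨S, hS⟩
  have h : ∀ t, ((S t).shrunk w).card + t ≤ ((S 0).shrunk w).card := by
    intro t
    induction t with
    | zero => exact le_rfl
    | succ t ih =>
      have := (hS t).card_shrunk_lt
      omega
  have := h (((S 0).shrunk w).card + 1)
  omega

theorem Invariant.exists_final (h : Invariant E w s) (test : PriceTest) :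
    ∃ s', Relation.ReflTransGen (Step test E w) s s' ∧ s'.cur = ∅ := by
  induction hn : (s.shrunk w).card using Nat.strong_induction_on generalizing s with
  | _ n ih =>
    rcases s.cur.eq_empty_or_nonempty with h0 | hne
    · exact ⟨s, .refl, h0⟩
    · obtain ⟨s₁, hs₁⟩ := h.exists_step hne test
      obtain ⟨s', h1, h2⟩ := ih _ (hn ▸ hs₁.card_shrunk_lt) (h.step hs₁) rfl
      exact ⟨s', .head hs₁ h1, h2⟩

theorem isLevelMinimal_empty {r : ℝ → ℝ → Prop} {G : Finset (A × B)} (h : IsMCM G ∅) :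
    IsLevelMinimal r G w ∅ :=
  ⟨h, fun _ _ _ _ c hc => by simp at hc⟩

theorem Invariant.isLevelMinimal_chosen (h : Invariant E w s) (h0 : s.cur = ∅) :
    IsLevelMinimal (· ≤ ·) E w s.chosen := by
  simpa using h.extend ∅ (isLevelMinimal_empty (h0 ▸ h.isMCM_edges))

/-- The algorithm itself, run to its end, serves as the existence proof. -/
theorem exists_isLevelMinimal [Fintype A] [Fintype B] (E : Finset (A × B)) (w : A × B → ℝ) :
    ∃ C, IsLevelMinimal (· ≤ ·) E w C := by
  obtain ⟨M, hM⟩ := exists_isMCM E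
  have h := Invariant.start (w := w) hM
  obtain ⟨s, hs, h0⟩ := h.exists_final .full
  exact ⟨_, (h.of_reachable hs).isLevelMinimal_chosen h0⟩

/-! ### The flag -/

/-- Take a level minimal `S₁` with an edge `g` of bottleneck weight. As no heaviest edge is forced,
some bottleneck assignment `N` avoids `g`. A level minimal matching of `N` together with all lighter
edges is level minimal in `G` and avoids `g`. -/
theorem exists_two_isLevelMinimal [Fintype A] [Fintype B] {G M : Finset (A × B)}
    (hM : IsMCM G M) (hne : M.Nonempty) (hbot : ∀ N, IsMCM G N → ∀ c ∈ M, ∃ f ∈ N, w c ≤ w f)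
    (haug : ∀ e ∈ heaviest w M, HasAugPath ((sublevel w G M).erase e) (M.erase e)) :
    ∃ S₁ S₂, S₁ ≠ S₂ ∧ IsLevelMinimal (· ≤ ·) G w S₁ ∧ IsLevelMinimal (· ≤ ·) G w S₂ := by
  obtain ⟨S₁, hS₁⟩ := exists_isLevelMinimal G w
  obtain ⟨e, he⟩ := heaviest_nonempty (w := w) hne
  obtain ⟨heM, hmax⟩ := mem_heaviest.1 he
  obtain ⟨g, hg, heg⟩ := hbot S₁ hS₁.1 e heM
  have hge : w g ≤ w e := by
    obtain ⟨c, hc, hgc⟩ := hS₁.exists_le isLevelRel_le hM hg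
    exact hgc.trans (hmax c hc)
  obtain ⟨N, hN, hNle, hgN⟩ : ∃ N, IsMCM G N ∧ (∀ f ∈ N, w f ≤ w e) ∧ g ∉ N := by
    by_cases hgM : g ∈ M
    · obtain ⟨N, hN, hNs⟩ := exists_isMCM_of_hasAugPath hM hgM
        (fun f hf => Finset.mem_filter.2 ⟨hM.1.1 hf, f, hf, le_rfl⟩)
        (Finset.filter_subset _ _)
        (haug g (mem_heaviest.2 ⟨hgM, fun f hf => (hmax f hf).trans heg⟩))
      refine ⟨N, hN, fun f hf => ?_, fun h => (Finset.mem_erase.1 (hNs h)).1 rfl⟩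
      obtain ⟨-, c, hc, hfc⟩ := Finset.mem_filter.1 (Finset.mem_of_mem_erase (hNs hf))
      exact hfc.trans (hmax c hc)
    · exact ⟨M, hM, hmax, hgM⟩
  obtain ⟨S₂, hS₂⟩ := exists_isLevelMinimal (N ∪ G.filter (fun f => w f < w e)) w
  refine ⟨S₁, S₂, ?_, hS₁, ?_⟩
  · rintro rfl
    rcases Finset.mem_union.1 (hS₂.1.1.1 hg) with h | h
    · exact hgN h
    · exact absurd heg (not_le.2 (Finset.mem_filter.1 h).2)
  · have := IsLevelMinimal.union_of_light (G := G) (D := ∅) hN (Finset.empty_subset _)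
      Finset.subset_union_left (Finset.union_subset hN.1.1 (Finset.filter_subset _ _))
      (fun f hf c hc hlt => Finset.mem_union_right _
        (Finset.mem_filter.2 ⟨hf, hlt.trans_le (hNle c hc)⟩))
      (fun _ _ _ => Finset.empty_subset _) (by rwa [minus_empty])
    simpa using this

/-- Properties related to the flag that are preserved by the steps of the algorithm. -/
structure FlagInvariant (test : PriceTest) (E : Finset (A × B)) (w : A × B → ℝ)
    (s : State A B) : Prop where
  extend : s.flag = true → test = .full → ∀ r, IsLevelRel r → ∀ S,
    IsLevelMinimal r (testEdges .full E s) w S → IsLevelMinimal r E w (s.chosen ∪ S)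
  two : s.flag = false → ∃ M₁ M₂, M₁ ≠ M₂ ∧ IsLevelMinimal (· ≤ ·) E w M₁ ∧
    IsLevelMinimal (· ≤ ·) E w M₂

theorem FlagInvariant.start [Fintype A] [Fintype B] (M₀ : Finset (A × B)) :
    FlagInvariant test E w (State.start E M₀) := by
  constructor
  · intro _ _ r _ S hS
    have hE : testEdges .full E (State.start E M₀) = E := by
      ext f
      simp [mem_testEdges_full, State.start]
    rw [hE] at hS
    simpa [State.start] using hS
  · intro h
    simp [State.start] at h

theorem Invariant.disjoint_chosen (h : Invariant E w s) {S : Finset (A × B)}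
    (hS : S ⊆ testEdges .full E s) : Disjoint S s.chosen :=
  Finset.disjoint_left.2 fun f hf hc =>
    h.chosen_agents f hc (mem_testEdges_full.1 (hS hf)).2.1

theorem FlagInvariant.exists_two [Fintype A] [Fintype B] (hF : FlagInvariant test E w s)
    (h : Invariant E w s) {e : A × B} (he : e ∈ heaviest w s.cur)
    (haug : ¬ HasAugPath ((s.shrunk w).erase e) (s.cur.erase e))
    (hno : s.NoPositive test E w) (hflag : s.flag = true) :
    ∃ M₁ M₂, M₁ ≠ M₂ ∧ IsLevelMinimal (· ≤ ·) E w M₁ ∧ IsLevelMinimal (· ≤ ·) E w M₂ := by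
  obtain ⟨hec, hmax⟩ := mem_heaviest.1 he
  have hM := h.isMCM_testEdges test
  obtain ⟨S₁, S₂, hne, h1, h2⟩ := exists_two_isLevelMinimal (w := w) hM ⟨e, hec⟩ (by
      intro N hN c hc
      by_contra! hlt
      have hNs : N ⊆ s.shrunk w := fun f hf => mem_shrunk_of_lt
        (h.light f (h.testEdges_subset (hN.1.1 hf)) c hc (hlt f hf)) hc (hlt f hf)
      have heN := mem_of_not_hasAugPath hM hN hec cur_subset_shrunk hNs haug
      exact absurd (hmax c hc) (not_le.2 (hlt e heN))) (by
      intro f hf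
      by_contra hfaug
      have : f ∈ positiveEdges w (testEdges test E s) s.cur ∩ heaviest w s.cur :=
        Finset.mem_inter.2 ⟨Finset.mem_filter.2 ⟨(mem_heaviest.1 hf).1, hfaug⟩, hf⟩
      rw [hno] at this
      simp at this)
  -- In the pruned version the test set is the current edge set; in the full version the flag, still
  -- true before this iteration, allows lifting from the unpruned graph.
  have hext : ∀ S, IsLevelMinimal (· ≤ ·) (testEdges test E s) w S →
      IsLevelMinimal (· ≤ ·) E w (s.chosen ∪ S) := by
    cases test with
    | pruned => exact h.extend
    | full => exact hF.extend hflag rfl _ isLevelRel_le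
  refine ⟨_, _, fun heq => hne ?_, hext _ h1, hext _ h2⟩
  have hd := fun S (hS : IsLevelMinimal (· ≤ ·) (testEdges test E s) w S) =>
    (h.disjoint_chosen (hS.1.1.1.trans h.testEdges_subset)).symm
  rw [← Finset.union_sdiff_cancel_left (hd _ h1), heq, Finset.union_sdiff_cancel_left (hd _ h2)]

theorem FlagInvariant.step [Fintype A] [Fintype B] (hF : FlagInvariant test E w s)
    (h : Invariant E w s) (hs : Step test E w s s') : FlagInvariant test E w s' := by
  cases hs with
  | improve e R he hR hne => exact ⟨hF.extend, hF.two⟩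
  | critical e R he hR heq =>
    subst heq
    have hec := (mem_heaviest.1 he).1
    have haug := hR.not_hasAugPath h.isMCM_edges hec
    by_cases hno : s.NoPositive test E w
    · constructor
      · intro hflag
        simp [State.lock, hno] at hflag
      · intro _
        cases hflag : s.flag with
        | false => exact hF.two hflag
        | true => exact hF.exists_two h he haug hno hflag
    · have hflag : (s.lock test E w e).flag = s.flag := if_neg hno
      constructor
      · rintro h1 rfl r hr S hS
        rw [testEdges_lock] at hS
        have hX : s.selected .full E w e = positiveEdges w (testEdges .full E s) s.cur :=
          if_neg hno
        have := hF.extend (hflag ▸ h1) rfl r hr _ (IsLevelMinimal.union hr h.isMCM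
          (selected_subset_cur hec)
          -- As the flag stays true, only edges that passed the price test are selected, and these
          -- are forced in the whole unpruned remaining graph.
          (fun N hN hle => hX ▸ h.positiveEdges_subset hN hle) hS)
        rwa [Finset.union_comm S, ← Finset.union_assoc] at this
      · exact fun h1 => hF.two (hflag ▸ h1)

theorem FlagInvariant.of_reachable [Fintype A] [Fintype B] {M₀ : Finset (A × B)}
    (hM : IsMCM E M₀) (hs : Reachable test E w M₀ s) : FlagInvariant test E w s := by
  induction hs with
  | refl => exact .start M₀
  | tail h hs ih => exact ih.step ((Invariant.start hM).of_reachable h) hs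

theorem run_correct [Fintype A] [Fintype B] {M₀ : Finset (A × B)} (hM : IsMCM E M₀)
    (hs : Reachable test E w M₀ s) (h0 : s.cur = ∅) :
    IsMCM E s.chosen ∧ IsSeqBAP E w s.chosen ∧
      (s.flag = false → ∃ M, IsSeqBAP E w M ∧ M ≠ s.chosen) ∧
      (test = PriceTest.full → s.flag = true →
        IsLexBAP E w s.chosen ∧ (∀ M, IsLexBAP E w M → M = s.chosen) ∧
        (∀ M, IsSeqBAP E w M → M = s.chosen)) := by
  have h := (Invariant.start (w := w) hM).of_reachable hs
  have hF := FlagInvariant.of_reachable hM hs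
  have hC := h.isLevelMinimal_chosen h0
  refine ⟨hC.1, hC.isSeqBAP, fun hflag => ?_, fun htest hflag => ?_⟩
  · obtain ⟨M₁, M₂, hne, h1, h2⟩ := hF.two hflag
    by_cases h3 : M₁ = s.chosen
    · exact ⟨M₂, h2.isSeqBAP, fun h4 => hne (h3.trans h4.symm)⟩
    · exact ⟨M₁, h1.isSeqBAP, h3⟩
  · have hL : IsLevelMinimal (· < ·) E w s.chosen := by
      simpa using hF.extend hflag htest _ isLevelRel_lt ∅
        (isLevelMinimal_empty (h0 ▸ h.isMCM))
    exact ⟨hL.isLexBAP, fun M hM => hL.eq_of_isLexBAP hM, fun M hM => hL.eq_of_isSeqBAP hM⟩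

/-! ### A deterministic run -/

/-! ### Independence of the weights off the edge set -/

section Congr

variable {test : PriceTest} {E M T : Finset (A × B)} {w w' : A × B → ℝ} {s s' : State A B}

theorem heaviest_congr (hw : ∀ e ∈ E, w e = w' e) (hM : M ⊆ E) :
    heaviest w M = heaviest w' M := by
  refine Finset.filter_congr fun e he => forall₂_congr fun f hf => ?_
  rw [hw e (hM he), hw f (hM hf)]

theorem sublevel_congr (hw : ∀ e ∈ E, w e = w' e) (hT : T ⊆ E) (hM : M ⊆ E) :
    sublevel w T M = sublevel w' T M := by
  refine Finset.filter_congr fun e he => exists_congr fun f => and_congr_right fun hf => ?_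
  rw [hw e (hT he), hw f (hM hf)]

theorem shrunk_congr (hw : ∀ e ∈ E, w e = w' e) (hs : s.edges ⊆ E) (hM : s.cur ⊆ E) :
    s.shrunk w = s.shrunk w' := by
  refine congrArg (s.cur ∪ ·) (Finset.filter_congr fun e he => exists_congr fun f =>
    and_congr_right fun hf => ?_)
  rw [hw e (hs he), hw f (hM hf)]

/-- Needed because the agents assign weight 0 to pairs that are not edges, whereas `w` is arbitrary
there. -/
theorem Step.congr (hw : ∀ e ∈ E, w e = w' e) (hs : s.edges ⊆ E) (hM : s.cur ⊆ E)
    (h : Step test E w s s') : Step test E w' s s' := by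
  have hsh := shrunk_congr hw hs hM
  have hhv := heaviest_congr hw hM
  have hT : testEdges test E s ⊆ E := by
    cases test with
    | pruned => exact hs
    | full => exact Finset.filter_subset _ _
  have hpos : positiveEdges w (testEdges test E s) s.cur =
      positiveEdges w' (testEdges test E s) s.cur := by
    simp only [positiveEdges, sublevel_congr hw hT hM]
  have hno : s.NoPositive test E w ↔ s.NoPositive test E w' := by
    rw [State.NoPositive, State.NoPositive, hpos, hhv]
  have hsel : ∀ e, s.selected test E w e = s.selected test E w' e := fun e =>
    if_congr hno (by rw [hpos]) hpos
  have hflag : ∀ e, (s.lock test E w e).flag = (s.lock test E w' e).flag := fun e =>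
    if_congr hno rfl rfl
  have hlock : ∀ e, s.lock test E w e = s.lock test E w' e := fun e => by
    refine State.ext ?_ ?_ ?_ ?_ ?_ (hflag e) <;> simp only [State.lock] <;> rw [hsel]
    rw [hsh]
  cases h with
  | improve e R he hR hne =>
    rw [hsh] at hR ⊢
    exact Step.improve s e R (hhv ▸ he) hR hne
  | critical e R he hR heq =>
    rw [hsh] at hR
    rw [hlock]
    exact Step.critical s e R (hhv ▸ he) hR heq

end Congr

/-- Some iteration of the loop if there is one, and no change otherwise. -/
def State.next (test : PriceTest) (E : Finset (A × B)) (w : A × B → ℝ) (s : State A B) :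
    State A B :=
  if h : ∃ s', Step test E w s s' then h.choose else s

/-- A run of the algorithm, continued by constant states. -/
def runState [Fintype A] [Fintype B] (test : PriceTest) (E : Finset (A × B)) (w : A × B → ℝ)
    (M₀ : Finset (A × B)) : ℕ → State A B
  | 0 => State.start E M₀
  | n + 1 => (runState test E w M₀ n).next test E w

theorem State.next_eq_or_step (test : PriceTest) (E : Finset (A × B)) (w : A × B → ℝ)
    (s : State A B) : s.next test E w = s ∨ Step test E w s (s.next test E w) := by
  rw [State.next]
  split_ifs with h
  · exact Or.inr h.choose_spec
  · exact Or.inl rfl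

theorem State.next_of_cur_eq_empty {test : PriceTest} {E : Finset (A × B)} {w : A × B → ℝ}
    {s : State A B} (h : s.cur = ∅) : s.next test E w = s := by
  rw [State.next, dif_neg]
  rintro ⟨s', hs⟩
  cases hs with
  | improve e R he => simp [mem_heaviest, h] at he
  | critical e R he => simp [mem_heaviest, h] at he

section Run

variable [Fintype A] [Fintype B] {test : PriceTest} {E M₀ : Finset (A × B)} {w : A × B → ℝ}

theorem invariant_runState (hM : IsMCM E M₀) (n : ℕ) :
    Invariant E w (runState test E w M₀ n) := by
  induction n with
  | zero => exact .start hM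
  | succ n ih =>
    rw [runState]
    rcases State.next_eq_or_step test E w (runState test E w M₀ n) with h | h
    · rwa [h]
    · exact ih.step h

theorem exists_runState_cur_eq_empty (hM : IsMCM E M₀) :
    ∃ n, (runState test E w M₀ n).cur = ∅ := by
  by_contra! hne
  refine not_exists_infinite_run (test := test) (E := E) (w := w)
    ⟨runState test E w M₀, fun n => ?_⟩
  have h := (invariant_runState (test := test) (w := w) hM n).exists_step (hne n) test
  rw [runState, State.next, dif_pos h]
  exact h.choose_spec

theorem runState_cur_eq_empty_of_le {n m : ℕ} (h : n ≤ m)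
    (h0 : (runState test E w M₀ n).cur = ∅) : (runState test E w M₀ m).cur = ∅ := by
  induction m, h using Nat.le_induction with
  | base => exact h0
  | succ m _ ih => rwa [runState, State.next_of_cur_eq_empty ih]

end Run

/-! ### Flooding -/

/-- The memory of an agent: its name, the time, and for every edge it knows the weight of the edge
and whether the edge belongs to the initial matching. -/
structure Memory (A : Type u) (B : Type v) where
  name : A
  time : ℕ
  know : A × B → Option (ℝ × Bool)

/-- The edges that are known. -/
def knownEdges [Fintype A] [Fintype B] (K : A × B → Option (ℝ × Bool)) : Finset (A × B) :=
  Finset.univ.filter (fun e => K e ≠ none)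

/-- The known edges of the initial matching. -/
def knownMatching [Fintype A] [Fintype B] (K : A × B → Option (ℝ × Bool)) : Finset (A × B) :=
  Finset.univ.filter (fun e => ∃ r, K e = some (r, true))

/-- The known weights. -/
def knownWeight (K : A × B → Option (ℝ × Bool)) (e : A × B) : ℝ :=
  ((K e).map Prod.fst).getD 0

/-- The state of the algorithm that an agent computes from what it knows; the run begins at time
`T`. -/
def Memory.state [Fintype A] [Fintype B] (test : PriceTest) (T : ℕ) (m : Memory A B) :
    State A B :=
  runState test (knownEdges m.know) (knownWeight m.know) (knownMatching m.know) (m.time - T)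

/-- Until the time `T` all agents pass on what they know, one edge at a time and every edge
sufficiently often. Then they all carry out the same run of the algorithm. -/
def floodProtocol [Fintype A] [Fintype B] [Encodable (A × B)] (test : PriceTest) (T : ℕ) :
    Protocol A B where
  Mem := Memory A B
  init i L := ⟨i, 0, fun e =>
    if e.1 = i then (L.weight e.2).map (fun r => (r, decide (e.2 ∈ L.matched))) else none⟩
  send m := (Encodable.decode m.time.unpair.1).bind fun e =>
    (m.know e).map fun p => ⟨e, p.1, p.2⟩
  receive m f := ⟨m.name, m.time + 1, fun e =>
    (m.know e).or (if h : ∃ p : ℝ × Bool, ∃ k, f k = some ⟨e, p.1, p.2⟩ then some h.choose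
      else none)⟩
  vars m := (m.state test T).localVars m.name
  halted m := decide (T ≤ m.time ∧ (m.state test T).cur = ∅)

/-- Everything there is to know. -/
def fullKnowledge (E : Finset (A × B)) (w : A × B → ℝ) (M₀ : Finset (A × B)) (e : A × B) :
    Option (ℝ × Bool) :=
  if e ∈ E then some (w e, decide (e ∈ M₀)) else none

theorem knownWeight_fullKnowledge {E M₀ : Finset (A × B)} {w : A × B → ℝ} {e : A × B}
    (he : e ∈ E) : knownWeight (fullKnowledge E w M₀) e = w e := by
  simp [knownWeight, fullKnowledge, he]

section Flood

variable [Fintype A] [Fintype B]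

theorem knownEdges_fullKnowledge (E : Finset (A × B)) (w : A × B → ℝ) (M₀ : Finset (A × B)) :
    knownEdges (fullKnowledge E w M₀) = E := by
  ext e
  simp [knownEdges, fullKnowledge]

theorem knownMatching_fullKnowledge {E M₀ : Finset (A × B)} (w : A × B → ℝ) (h : M₀ ⊆ E) :
    knownMatching (fullKnowledge E w M₀) = M₀ := by
  ext e
  by_cases he : e ∈ E
  · simp [knownMatching, fullKnowledge, he]
  · simpa [knownMatching, fullKnowledge, he] using fun h' => he (h h')

/-- During flooding an agent's picture of the graph is incomplete, but its part of the initial state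
involves only its own edges. -/
theorem localVars_start_congr {E M₀ E' M' : Finset (A × B)} {i : A}
    (hE : ∀ j, (i, j) ∈ E' ↔ (i, j) ∈ E) (hM : ∀ j, (i, j) ∈ M' ↔ (i, j) ∈ M₀) :
    (State.start E' M').localVars i = (State.start E M₀).localVars i := by
  simp only [State.localVars, LocalVars.mk.injEq]
  exact ⟨rfl, rfl, Finset.filter_congr fun j _ => hE j, Finset.filter_congr fun j _ => hM j,
    rfl, rfl⟩

variable [Encodable (A × B)] (test : PriceTest) (T : ℕ) (C : SimpleGraph A)
  (E : Finset (A × B)) (w : A × B → ℝ) (M₀ : Finset (A × B))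

/-- The memory of the agent `i` at time `t`. -/
def floodMemory (t : ℕ) (i : A) : Memory A B :=
  (floodProtocol test T).memory C (localInput C E w M₀) t i

variable {test T C E w M₀}

theorem floodMemory_name_time (t : ℕ) (i : A) :
    (floodMemory test T C E w M₀ t i).name = i ∧ (floodMemory test T C E w M₀ t i).time = t := by
  induction t with
  | zero => exact ⟨rfl, rfl⟩
  | succ t ih => exact ⟨ih.1, congrArg (· + 1) ih.2⟩

theorem send_eq (t : ℕ) (i : A) :
    (floodProtocol test T).send (floodMemory test T C E w M₀ t i) =
      (Encodable.decode t.unpair.1).bind fun e =>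
        ((floodMemory test T C E w M₀ t i).know e).map fun p => ⟨e, p.1, p.2⟩ := by
  change (Encodable.decode (floodMemory test T C E w M₀ t i).time.unpair.1).bind _ = _
  rw [(floodMemory_name_time t i).2]

theorem know_zero (i : A) (e : A × B) :
    (floodMemory test T C E w M₀ 0 i).know e =
      if e.1 = i then fullKnowledge E w M₀ e else none := by
  obtain ⟨a, j⟩ := e
  change (if a = i then ((if (i, j) ∈ E then some (w (i, j)) else none).map
    (fun r => (r, decide (j ∈ Finset.univ.filter (fun j => (i, j) ∈ M₀))))) else none) = _
  by_cases h : a = i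
  · subst h
    by_cases hE : (a, j) ∈ E <;> simp [fullKnowledge, hE]
  · simp [h]

theorem know_succ (t : ℕ) (i : A) (e : A × B) :
    (floodMemory test T C E w M₀ (t + 1) i).know e =
      ((floodMemory test T C E w M₀ t i).know e).or
        (if h : ∃ p : ℝ × Bool, ∃ k, (if C.Adj i k then
            (floodProtocol test T).send (floodMemory test T C E w M₀ t k) else none) =
              some (⟨e, p.1, p.2⟩ : Message A B) then some h.choose else none) :=
  rfl

theorem send_eq_some {t : ℕ} {i : A} {m : Message A B}
    (h : (floodProtocol test T).send (floodMemory test T C E w M₀ t i) = some m) :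
    (floodMemory test T C E w M₀ t i).know m.edge = some (m.weight, m.bit) := by
  rw [send_eq, Option.bind_eq_some_iff] at h
  obtain ⟨e, -, h⟩ := h
  obtain ⟨p, hp, rfl⟩ := Option.map_eq_some_iff.1 h
  exact hp

theorem know_sound (t : ℕ) (i : A) (e : A × B) (p : ℝ × Bool)
    (h : (floodMemory test T C E w M₀ t i).know e = some p) :
    fullKnowledge E w M₀ e = some p := by
  induction t generalizing i e p with
  | zero =>
    rw [know_zero] at h
    split_ifs at h
    exact h
  | succ t ih =>
    rw [know_succ, Option.or_eq_some_iff] at h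
    rcases h with h | ⟨-, h⟩
    · exact ih i e p h
    · split_ifs at h with hex
      obtain ⟨k, hk⟩ := hex.choose_spec
      obtain rfl := Option.some.inj h
      split_ifs at hk
      exact ih k e _ (send_eq_some hk)

theorem know_mono {t t' : ℕ} (htt : t ≤ t') (i : A) (e : A × B)
    (h : (floodMemory test T C E w M₀ t i).know e = fullKnowledge E w M₀ e) :
    (floodMemory test T C E w M₀ t' i).know e = fullKnowledge E w M₀ e := by
  induction t', htt using Nat.le_induction with
  | base => exact h
  | succ t' _ ih =>
    cases hK : fullKnowledge E w M₀ e with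
    | none =>
      by_contra hne
      obtain ⟨p, hp⟩ := Option.ne_none_iff_exists'.1 hne
      rw [know_sound _ _ _ _ hp] at hK
      simp at hK
    | some p => rw [know_succ, ih, hK, Option.some_or]

theorem know_own (t : ℕ) (e : A × B) :
    (floodMemory test T C E w M₀ t e.1).know e = fullKnowledge E w M₀ e :=
  know_mono (Nat.zero_le t) _ _ (by rw [know_zero, if_pos rfl])

/-- Induction along the walk. At time `Nat.pair (Encodable.encode e) n` every agent that knows `e`
sends it. Since these times increase with n, the knowledge advances at least one vertex from each of
them to the next. -/
theorem know_of_walk {i k : A} (q : C.Walk i k) (e : A × B) (hk : k = e.1) (t : ℕ)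
    (ht : Nat.pair (Encodable.encode e) q.length ≤ t) :
    (floodMemory test T C E w M₀ t i).know e = fullKnowledge E w M₀ e := by
  induction q generalizing t with
  | nil => exact hk ▸ know_own t e
  | @cons i l _ hadj q ih =>
    have hlt : Nat.pair (Encodable.encode e) q.length <
        Nat.pair (Encodable.encode e) (q.length + 1) :=
      Nat.pair_lt_pair_right _ (Nat.lt_succ_self _)
    rw [SimpleGraph.Walk.length_cons] at ht
    refine know_mono (hlt.trans_le ht : _ + 1 ≤ t) i e ?_
    have hl := ih hk _ le_rfl
    cases hK : fullKnowledge E w M₀ e with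
    | none =>
      by_contra hne
      obtain ⟨p, hp⟩ := Option.ne_none_iff_exists'.1 hne
      rw [know_sound _ _ _ _ hp] at hK
      simp at hK
    | some p =>
      suffices h : (floodMemory test T C E w M₀
          (Nat.pair (Encodable.encode e) q.length + 1) i).know e ≠ none by
        obtain ⟨p', hp'⟩ := Option.ne_none_iff_exists'.1 h
        rw [hp', ← know_sound _ _ _ _ hp', hK]
      rw [know_succ, dif_pos]
      · simp
      · refine ⟨p, l, ?_⟩
        rw [if_pos hadj, send_eq, Nat.unpair_pair, Encodable.encodek, Option.bind_some, hl, hK]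
        rfl

theorem know_eq_of_le (hC : C.Connected)
    (hT : ∀ e : A × B, Nat.pair (Encodable.encode e) (Fintype.card A) ≤ T) {t : ℕ} (ht : T ≤ t)
    (i : A) : (floodMemory test T C E w M₀ t i).know = fullKnowledge E w M₀ := by
  funext e
  obtain ⟨q⟩ := hC.preconnected i e.1
  refine know_of_walk q.bypass e rfl t (le_trans ?_ ((hT e).trans ht))
  -- A path has fewer edges than there are agents, whence the second argument `Fintype.card A` in
  -- the bound on `T`.
  exact (Nat.pair_lt_pair_right _ (SimpleGraph.Walk.IsPath.length_lt q.bypass_isPath)).le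

theorem floodProtocol_implements (hC : C.Connected) (hM : IsMCM E M₀)
    (hT : ∀ e : A × B, Nat.pair (Encodable.encode e) (Fintype.card A) ≤ T) :
    (floodProtocol test T).Implements test C E w M₀ := by
  set w' := knownWeight (fullKnowledge E w M₀) with hw'
  have hw : ∀ e ∈ E, w' e = w e := fun e he => knownWeight_fullKnowledge he
  have hstate : ∀ t, T ≤ t → ∀ i, (floodMemory test T C E w M₀ t i).state test T =
      runState test E w' M₀ (t - T) := by
    intro t ht i
    rw [Memory.state, know_eq_of_le hC hT ht, knownEdges_fullKnowledge,
      knownMatching_fullKnowledge w hM.1.1, (floodMemory_name_time t i).2]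
  -- The truncated subtraction keeps the joint state at the initial one until `T`.
  refine ⟨fun t i m hm => ?_, fun t => runState test E w' M₀ (t - T), ?_, fun t => ?_,
    fun t i => ?_, ?_⟩
  · have := know_sound _ _ _ _ (send_eq_some hm)
    rw [fullKnowledge] at this
    split_ifs at this with he
    exact ⟨he, (congrArg Prod.fst (Option.some.inj this)).symm⟩
  · simp [runState]
  · rcases lt_or_ge t T with ht | ht
    · left
      beta_reduce
      rw [Nat.sub_eq_zero_of_le ht.le, Nat.sub_eq_zero_of_le (show t + 1 ≤ T from ht)]
    · have h := invariant_runState (test := test) (w := w') hM (t - T)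
      have hsub : testEdges .full E (runState test E w' M₀ (t - T)) ⊆ E :=
        Finset.filter_subset _ _
      simp only [Nat.sub_add_comm ht, runState]
      exact (State.next_eq_or_step test E w' _).imp id
        (Step.congr hw (h.edges_subset.trans hsub) (h.isMCM.1.1.trans hsub))
  · change ((floodMemory test T C E w M₀ t i).state test T).localVars
      (floodMemory test T C E w M₀ t i).name = _
    rw [(floodMemory_name_time t i).1]
    rcases lt_or_ge t T with ht | ht
    · beta_reduce
      rw [Memory.state, (floodMemory_name_time t i).2, Nat.sub_eq_zero_of_le ht.le, runState,
        runState]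
      refine localVars_start_congr (fun j => ?_) (fun j => ?_)
      · conv_rhs => rw [← knownEdges_fullKnowledge E w M₀]
        simp only [knownEdges, Finset.mem_filter]
        rw [know_own t (i, j)]
      · conv_rhs => rw [← knownMatching_fullKnowledge w hM.1.1]
        simp only [knownMatching, Finset.mem_filter]
        rw [know_own t (i, j)]
    · rw [hstate t ht i]
  · have hex := exists_runState_cur_eq_empty (test := test) (w := w') hM
    -- The least index with empty matching is taken because halting must not be reported late or
    -- early.
    refine ⟨T + Nat.find hex, ?_, fun t i => ?_⟩
    · beta_reduce
      rw [Nat.add_sub_cancel_left]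
      exact Nat.find_spec hex
    · change decide (T ≤ (floodMemory test T C E w M₀ t i).time ∧
        ((floodMemory test T C E w M₀ t i).state test T).cur = ∅) = true ↔ _
      rw [decide_eq_true_iff, (floodMemory_name_time t i).2]
      constructor
      · rintro ⟨h1, h2⟩
        rw [hstate t h1] at h2
        have := Nat.find_min' hex h2
        omega
      · intro h
        have h1 : T ≤ t := by omega
        rw [hstate t h1]
        exact ⟨h1, runState_cur_eq_empty_of_le (by omega) (Nat.find_spec hex)⟩

end Flood

/-- The flooding time is a maximum over all conceivable edges, so it does not depend on the
communication graph or the assignment problem. -/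
theorem exists_protocol [Fintype A] [Fintype B] (test : PriceTest) :
    ∃ P : Protocol A B, ∀ (C : SimpleGraph A) (E : Finset (A × B)) (w : A × B → ℝ)
      (M₀ : Finset (A × B)), C.Connected → IsMCM E M₀ → P.Implements test C E w M₀ := by
  let _ : Encodable (A × B) := Fintype.toEncodable _
  exact ⟨floodProtocol test
      (Finset.univ.sup fun e : A × B => Nat.pair (Encodable.encode e) (Fintype.card A)),
    fun C E w M₀ hC hM => floodProtocol_implements hC hM fun e =>
      Finset.le_sup (f := fun e : A × B => Nat.pair (Encodable.encode e) (Fintype.card A))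
        (Finset.mem_univ e)⟩

end

end Assignment

theorem mainTheorem6 {A : Type*} {B : Type*} [Fintype A] [Fintype B] :
    (∀ (test : Assignment.PriceTest) (E : Finset (A × B)) (w : A × B → ℝ) (M₀ : Finset (A × B)),
      Assignment.IsMCM E M₀ →
      (¬ ∃ S : ℕ → Assignment.State A B, S 0 = Assignment.State.start E M₀ ∧
        ∀ t, Assignment.Step test E w (S t) (S (t + 1))) ∧
      ∀ s : Assignment.State A B, Assignment.Reachable test E w M₀ s →
        (s.cur.Nonempty → ∃ s', Assignment.Step test E w s s') ∧
        (s.cur = ∅ →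
          Assignment.IsMCM E s.chosen ∧
          Assignment.IsSeqBAP E w s.chosen ∧
          (s.flag = false → ∃ M, Assignment.IsSeqBAP E w M ∧ M ≠ s.chosen) ∧
          (test = Assignment.PriceTest.full → s.flag = true →
            Assignment.IsLexBAP E w s.chosen ∧
            (∀ M, Assignment.IsLexBAP E w M → M = s.chosen) ∧
            (∀ M, Assignment.IsSeqBAP E w M → M = s.chosen)))) ∧
    (∀ test : Assignment.PriceTest, ∃ P : Assignment.Protocol A B,
      ∀ (C : SimpleGraph A) (E : Finset (A × B)) (w : A × B → ℝ) (M₀ : Finset (A × B)),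
        C.Connected → Assignment.IsMCM E M₀ →
        Fintype.card B ≤ Fintype.card A → M₀.card = Fintype.card B →
        P.Implements test C E w M₀) := by
  refine ⟨fun test E w M₀ hM => ⟨fun ⟨S, _, hS⟩ => Assignment.not_exists_infinite_run ⟨S, hS⟩,
    fun s hs => ⟨fun hne => ?_, fun h0 => Assignment.run_correct hM hs h0⟩⟩, fun test => ?_⟩
  · exact ((Assignment.Invariant.start hM).of_reachable hs).exists_step hne test
  · obtain ⟨P, hP⟩ := Assignment.exists_protocol (A := A) (B := B) test
    exact ⟨P, fun C E w M₀ hC hM _ _ => hP C E w M₀ hC hM⟩
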